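/- Let $L\ge 1$ be an integer, $\delta>0$, $\bar\gamma>0$ and $0\le R_1<R_2$. Let $\mathfrak h_1,\dots,\mathfrak h_L,\mathfrak g_1,\dots,\mathfrak g_L$ be Rayleigh random variables with density $r e^{-r^2/2}$, $r>0$ (scale parameter $1$), let $\epsilon_1,\dots,\epsilon_L$ be uniform on $(-\pi,\pi)$, and let the position of the receiver $D$ be a random point, uniformly distributed on the planar ring with centre $c$ (the position of the RIS), inner radius $R_1$ and outer radius $R_2$; all of these random variables are mutually independent. Put $$X=\Bigl|\sum_{l=1}^{L}\mathfrak h_l\,\mathfrak g_l\,e^{j\epsilon_l}\Bigr|^2,\qquad d_{RD}=\|D-c\|,\qquad \gamma_D=\bar\gamma\,\frac{X}{d_{RD}^{\delta}} .$$ Then: (a) for every $x>0$, $\displaystyle \mathbb P(X\le x)=1-\frac{2^{1-L}}{\Gamma(L)}\,(\sqrt x)^{L}\,\mathbf K_L(\sqrt x)$, where $\mathbf K_L(z)=\int_0^\infty e^{-z\cosh t}\cosh(Lt)\,dt$ is the modified Bessel function of the second kind; (b) $d_{RD}$ has the density $\dfrac{2r}{R_2^2-R_1^2}$ for $R_1\le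 r\le R_2$, and $0$ elsewhere; (c) $\gamma_D$ has a (nonnegative, measurable) probability density $f_D$, with $f_D(\gamma)=0$ for $\gamma\le 0$ and, for $\gamma>0$, $$f_D(\gamma)=\frac{1}{2\delta\bar\gamma\,\Gamma(L)(R_2^2-R_1^2)}\left[R_2^{2+\delta}\,G_{1,3}^{2,1}\!\left[\frac{R_2^\delta\gamma}{4\bar\gamma}\,\middle|\,{-\tfrac2\delta \atop L-1,\,0,\,-1-\tfrac2\delta}\right]-R_1^{2+\delta}\,G_{1,3}^{2,1}\!\left[\frac{R_1^\delta\gamma}{4\bar\gamma}\,\middle|\,{-\tfrac2\delta \atop L-1,\,0,\,-1-\tfrac2\delta}\right]\right],$$ where the second term is $0$ if $R_1=0$, and the Meijer $G$-function is, for $z>0$, $$G_{1,3}^{2,1}\!\left[z\,\middle|\,{-\tfrac2\delta \atop L-1,\,0,\,-1-\tfrac2\delta}\right]=\frac1{2\pi i}\int_{c_0-i\infty}^{c_0+i\infty}\frac{\Gamma(L-1-s)\,\Gamma(-s)\,\Gamma(1+\tfrac2\delta+s)}{\Gamma(2+\tfrac2\delta+s)}\,z^{s}\,ds ,$$ the integral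 over any vertical line $\operatorname{Re}s=c_0$ that separates the poles of $\Gamma(L-1-s)\Gamma(-s)$ from those of $\Gamma(1+\frac2\delta+s)$, that is, with $-1-\frac2\delta<c_0<0$; these integrals converge absolutely and do not depend on the choice of $c_0$. -/

import Mathlib

/-! Definitions: Rayleigh law, planar ring, RIS combining gain, Bessel `K`, Meijer `G`. -/

namespace RIS

noncomputable section

/-- Density of the Rayleigh law with scale parameter `σ > 0`:
`(r / σ²) exp (-r² / (2σ²))` for `r > 0`, and `0` otherwise. -/
def rayleighPDF (σ r : ℝ) : ℝ :=
  if 0 < r then r / σ ^ 2 * Real.exp (-r ^ 2 / (2 * σ ^ 2)) else 0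

/-- The Rayleigh law with scale parameter `σ > 0`. -/
def rayleighMeasure (σ : ℝ) : MeasureTheory.Measure ℝ :=
  MeasureTheory.volume.withDensity fun r => ENNReal.ofReal (rayleighPDF σ r)

/-- The closed planar ring with centre `c`, inner radius `R₁` and outer radius `R₂`. -/
def planarRing (c : EuclideanSpace ℝ (Fin 2)) (R₁ R₂ : ℝ) : Set (EuclideanSpace ℝ (Fin 2)) :=
  {x | R₁ ≤ dist x c ∧ dist x c ≤ R₂}

/-- The combining gain `|∑ₗ hₗ gₗ exp (j εₗ)|²` for amplitudes `hₗ`, `gₗ` and phase errors `εₗ`. -/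
def gain {L : ℕ} (h g ε : Fin L → ℝ) : ℝ :=
  ‖∑ l, ((h l * g l : ℝ) : ℂ) * Complex.exp (Complex.I * (ε l : ℂ))‖ ^ 2

/-- The received SNR `γ̄ X / d ^ δ` with combining gain `X` and path loss exponent `δ`, when the
distance from the surface to the receiver is `d`. -/
def snr {L : ℕ} (γbar δ : ℝ) (h g ε : Fin L → ℝ) (d : ℝ) : ℝ :=
  γbar * gain h g ε / d ^ δ

/-- The modified Bessel function of the second kind of real order `ν`, for `z > 0`:
`K_ν(z) = ∫₀^∞ exp (-z cosh t) cosh (ν t) dt`. -/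
def besselK (ν z : ℝ) : ℝ :=
  ∫ t in Set.Ioi (0 : ℝ), Real.exp (-z * Real.cosh t) * Real.cosh (ν * t)

/-- The Mellin–Barnes integrand of the Meijer function `G^{m,n}_{p,q}`:
`∏_{j ≤ m} Γ(b_j - s) ∏_{j ≤ n} Γ(1 - a_j + s)
  / (∏_{j > m} Γ(1 - b_j + s) ∏_{j > n} Γ(a_j - s)) * z ^ s`. -/
def meijerIntegrand (m n : ℕ) {p q : ℕ} (a : Fin p → ℂ) (b : Fin q → ℂ) (z s : ℂ) : ℂ :=
  (∏ j : Fin q, if (j : ℕ) < m then Complex.Gamma (b j - s)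
      else (Complex.Gamma (1 - b j + s))⁻¹) *
  (∏ j : Fin p, if (j : ℕ) < n then Complex.Gamma (1 - a j + s)
      else (Complex.Gamma (a j - s))⁻¹) * z ^ s

/-- The vertical line `Re s = c` separates the poles of the Mellin–Barnes integrand: the poles
`b_j + k` (`j ≤ m`) lie to the right and the poles `a_j - 1 - k` (`j ≤ n`) lie to the left. -/
def MeijerSeparates (m n : ℕ) {p q : ℕ} (a : Fin p → ℂ) (b : Fin q → ℂ) (c : ℝ) : Prop :=
  (∀ j : Fin q, (j : ℕ) < m → c < (b j).re) ∧ (∀ j : Fin p, (j : ℕ) < n → (a j).re - 1 < c)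

/-- The Mellin–Barnes integral `(1 / 2πi) ∫ … ds` over the upward vertical line `Re s = c`
(there `ds = i dy`). -/
def meijerLineIntegral (m n : ℕ) {p q : ℕ} (a : Fin p → ℂ) (b : Fin q → ℂ) (z : ℂ) (c : ℝ) : ℂ :=
  (1 / (2 * Real.pi * Complex.I)) *
    ∫ y : ℝ, meijerIntegrand m n a b z ((c : ℂ) + (y : ℂ) * Complex.I) * Complex.I

open Classical in
/-- The Meijer function `G^{m,n}_{p,q}(z | a; b)`: the Mellin–Barnes integral over a vertical line
that separates the two families of poles (`0` if there is no such line). -/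
def meijerG (m n : ℕ) {p q : ℕ} (a : Fin p → ℂ) (b : Fin q → ℂ) (z : ℂ) : ℂ :=
  if hc : ∃ c : ℝ, MeijerSeparates m n a b c then meijerLineIntegral m n a b z hc.choose else 0

/-- The Meijer function is well defined at `z`: some vertical line separates the poles, and over
every such line the Mellin–Barnes integral converges absolutely and has the value `meijerG`. -/
def MeijerGWellDefined (m n : ℕ) {p q : ℕ} (a : Fin p → ℂ) (b : Fin q → ℂ) (z : ℂ) : Prop :=
  (∃ c : ℝ, MeijerSeparates m n a b c) ∧
  ∀ c : ℝ, MeijerSeparates m n a b c →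
    MeasureTheory.Integrable
      (fun y : ℝ => meijerIntegrand m n a b z ((c : ℂ) + (y : ℂ) * Complex.I)) ∧
    meijerLineIntegral m n a b z c = meijerG m n a b z

end

end RIS

/-! Conditionally on the amplitudes `h`, the terms `g l * exp (j ε l)` are independent circular
Gaussians (Rayleigh modulus, uniform phase). A real combination of them with coefficients `h l` is
again one, scaled by `√(∑ h l ^ 2)` (`map_sum_circularGaussian`). Hence `X` has the law of `4 T E`,
where `T = ∑ h l ^ 2 / 2` is gamma of shape `L` and `E`, half a squared Rayleigh variable, is an
independent standard exponential (`map_gain_channelMeasure`).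

Conditioning on `T` expresses both the tail and the density of `X` through integrals `∫ t ^ (a - 2)
exp (-t - z / t) dt`: index `a = L + 1` for the tail, `a = L` for the density. The substitution `t =
√z e ^ u` identifies the first with `K_L`, which is (a). Polar coordinates give (b).

For (c), the density of `X` is mixed over the distance. With `v = r ^ δ * γ / (4 γbar)` the mixture
becomes a difference, at `R₂` and `R₁`, of averages `z ^ (-β) ∫₀^z v ^ (β - 1) k(v) dv` with `β = 1
+ 2 / δ` and `k` the kernel of index `L`. By Fubini such an average has Mellin transform `Γ(s) Γ(s +
L - 1) / (β - s)` on `0 < Re s < β`. Since `1 / (β - s) = Γ(β - s) / Γ(β - s + 1)`, this is the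
Gamma quotient of the Meijer integrand at `-s`, and Mellin inversion (`mellinInv_averagedKernel`)
identifies the average with the `G`-function. Inversion holds on every line of the strip, so
independence of the contour needs no contour shift. -/

namespace RIS

open MeasureTheory ProbabilityTheory Set Filter Topology
open scoped ENNReal

/-! ### Rayleigh, exponential and gamma laws -/

lemma measurable_rayleighPDF (σ : ℝ) : Measurable (rayleighPDF σ) := by
  unfold rayleighPDF
  exact Measurable.ite measurableSet_Ioi (by fun_prop) measurable_const

lemma lintegral_rayleighMeasure {F : ℝ → ℝ≥0∞} (hF : Measurable F) :
    ∫⁻ r, F r ∂rayleighMeasure 1 =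
      ∫⁻ r in Ioi 0, ENNReal.ofReal (r * Real.exp (-r ^ 2 / 2)) * F r := by
  rw [rayleighMeasure, lintegral_withDensity_eq_lintegral_mul _
    (measurable_rayleighPDF 1).ennreal_ofReal hF, ← lintegral_indicator measurableSet_Ioi]
  congr with r
  by_cases hr : 0 < r <;> simp [rayleighPDF, indicator, hr]

lemma lintegral_gammaMeasure (a : ℝ) {F : ℝ → ℝ≥0∞} (hF : Measurable F) :
    ∫⁻ x, F x ∂gammaMeasure a 1 =
      ∫⁻ x in Ioi 0, ENNReal.ofReal (x ^ (a - 1) * Real.exp (-x) / Real.Gamma a) * F x := by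
  have hm : Measurable (gammaPDF a 1) := (measurable_gammaPDFReal a 1).ennreal_ofReal
  rw [gammaMeasure, lintegral_withDensity_eq_lintegral_mul _ hm hF,
    ← lintegral_indicator measurableSet_Ioi]
  refine lintegral_congr_ae ?_
  -- `gammaPDFReal` uses the condition `0 ≤ x`, the target integral `0 < x`; the point `0` is null.
  filter_upwards [compl_mem_ae_iff.2 (measure_singleton (0 : ℝ))] with x hx
  have hx : x ≠ 0 := hx
  rcases hx.lt_or_gt with h | h
  · simp [gammaPDF, gammaPDFReal, h.not_ge, h.le]
  · simp only [Pi.mul_apply, gammaPDF, gammaPDFReal, h.le, if_true, indicator, mem_Ioi, h]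
    congr 2
    simp only [Real.one_rpow, one_mul]
    ring

/-- Half the square of a standard Rayleigh variable is exponential. -/
lemma map_sq_half_rayleighMeasure :
    (rayleighMeasure 1).map (fun r => r ^ 2 / 2) = gammaMeasure 1 1 := by
  refine Measure.ext_of_lintegral _ fun F hF => ?_
  rw [lintegral_map hF (by fun_prop), lintegral_rayleighMeasure (by fun_prop),
    lintegral_gammaMeasure 1 hF]
  have himg : (fun r : ℝ => r ^ 2 / 2) '' Ioi 0 = Ioi 0 := by
    ext y
    simp only [mem_image, mem_Ioi]
    constructor
    · rintro ⟨x, hx, rfl⟩; positivity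
    · intro hy
      exact ⟨√(2 * y), by positivity, by rw [Real.sq_sqrt (by positivity)]; ring⟩
  have hinj : InjOn (fun r : ℝ => r ^ 2 / 2) (Ioi 0) := by
    intro x hx y hy h
    have h' : x ^ 2 = y ^ 2 := by simpa using h
    exact (pow_left_inj₀ (le_of_lt hx) (le_of_lt hy) two_ne_zero).1 h'
  have key := lintegral_image_eq_lintegral_abs_deriv_mul (f' := fun r => r) measurableSet_Ioi
    (fun x _ => by
      have := ((hasDerivAt_pow 2 x).div_const 2).hasDerivWithinAt (s := Ioi 0)
      simpa using this) hinj
    (fun x => ENNReal.ofReal (x ^ ((1 : ℝ) - 1) * Real.exp (-x) / Real.Gamma 1) * F x)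
  rw [himg] at key
  rw [key]
  refine setLIntegral_congr_fun measurableSet_Ioi fun r hr => ?_
  have hr : 0 < r := hr
  rw [← mul_assoc, ← ENNReal.ofReal_mul (abs_nonneg _), abs_of_pos hr]
  simp [neg_div]

lemma isProbabilityMeasure_rayleighMeasure : IsProbabilityMeasure (rayleighMeasure 1) := by
  have : IsProbabilityMeasure ((rayleighMeasure 1).map (fun r => r ^ 2 / 2)) := by
    rw [map_sq_half_rayleighMeasure]
    exact isProbabilityMeasure_gammaMeasure one_pos one_pos
  exact Measure.isProbabilityMeasure_of_map (fun r : ℝ => r ^ 2 / 2)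

lemma lintegral_Ioo_rpow {a s : ℝ} (ha : 0 < a) (hs : 0 < s) :
    ∫⁻ x in Ioo 0 s, ENNReal.ofReal (x ^ (a - 1)) = ENNReal.ofReal (s ^ a / a) := by
  rw [← ofReal_integral_eq_lintegral_ofReal, ← integral_Ioc_eq_integral_Ioo,
    ← intervalIntegral.integral_of_le hs.le, integral_rpow (Or.inl (by linarith))]
  · simp [Real.zero_rpow ha.ne']
  · refine IntegrableOn.mono_set ?_ Ioo_subset_Ioc_self
    exact (intervalIntegral.intervalIntegrable_rpow' (by linarith)).1
  · filter_upwards [self_mem_ae_restrict measurableSet_Ioo] with x hx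
    exact Real.rpow_nonneg hx.1.le _

/-- Adding an independent exponential variable raises the shape of a gamma law by one. -/
lemma gammaMeasure_conv_one {a : ℝ} (ha : 0 < a) :
    gammaMeasure a 1 ∗ gammaMeasure 1 1 = gammaMeasure (a + 1) 1 := by
  have := isProbabilityMeasure_gammaMeasure ha one_pos
  have := isProbabilityMeasure_gammaMeasure (one_pos (α := ℝ)) one_pos
  refine Measure.ext_of_lintegral _ fun F hF => ?_
  rw [Measure.lintegral_conv hF, lintegral_gammaMeasure (a + 1) hF]
  -- The integrand in the variables `x` and `s = x + y`, supported on `0 < x < s`. The exponentials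
  -- combine to `exp (-s)`, so after Tonelli only `∫₀^s x ^ (a - 1) dx = s ^ a / a` remains.
  set K : ℝ → ℝ → ℝ≥0∞ := fun x s =>
    {p : ℝ × ℝ | 0 < p.1 ∧ p.1 < p.2}.indicator
      (fun p => ENNReal.ofReal (p.1 ^ (a - 1)) *
        (ENNReal.ofReal (Real.exp (-p.2) / Real.Gamma a) * F p.2)) (x, s) with hK
  have hΓ := Real.Gamma_pos_of_pos ha
  have hset : MeasurableSet {p : ℝ × ℝ | 0 < p.1 ∧ p.1 < p.2} :=
    (measurableSet_lt measurable_const measurable_fst).inter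
      (measurableSet_lt measurable_fst measurable_snd)
  have hKm : Measurable (Function.uncurry K) := by
    refine Measurable.indicator ?_ hset
    fun_prop
  have h1 : ∫⁻ x, ∫⁻ y, F (x + y) ∂gammaMeasure 1 1 ∂gammaMeasure a 1 = ∫⁻ x, ∫⁻ s, K x s := by
    rw [lintegral_gammaMeasure a (by fun_prop), ← lintegral_indicator measurableSet_Ioi]
    refine lintegral_congr fun x => ?_
    by_cases hx : 0 < x
    · rw [indicator_of_mem (show x ∈ Ioi 0 from hx), lintegral_gammaMeasure 1 (by fun_prop),
        ← lintegral_indicator measurableSet_Ioi, ← lintegral_const_mul _ (by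
          refine Measurable.indicator ?_ measurableSet_Ioi
          fun_prop), ← lintegral_add_left_eq_self (fun s => K x s) x]
      refine lintegral_congr fun y => ?_
      by_cases hy : 0 < y
      · have hxa := Real.rpow_nonneg hx.le (a - 1)
        simp only [hK, indicator, mem_Ioi, hy, if_true, mem_ofPred_eq, hx, lt_add_iff_pos_right,
          and_self]
        rw [← mul_assoc, ← mul_assoc, ← ENNReal.ofReal_mul (by positivity),
          ← ENNReal.ofReal_mul (by positivity)]
        congr 2
        rw [neg_add, Real.exp_add]
        simp
        ring
      · simp [hK, indicator, hy]
    · simp [hK, indicator, hx]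
  rw [h1, lintegral_lintegral_swap hKm.aemeasurable, ← lintegral_indicator measurableSet_Ioi]
  refine lintegral_congr fun s => ?_
  by_cases hs : 0 < s
  · have h2 : ∀ x, K x s = (Ioo 0 s).indicator (fun x => ENNReal.ofReal (x ^ (a - 1))) x *
        (ENNReal.ofReal (Real.exp (-s) / Real.Gamma a) * F s) := by
      intro x
      by_cases hx : 0 < x ∧ x < s <;> simp [hK, indicator, hx]
    simp_rw [h2]
    rw [lintegral_mul_const _ (Measurable.indicator (by fun_prop) measurableSet_Ioo),
      lintegral_indicator measurableSet_Ioo, lintegral_Ioo_rpow ha hs,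
      indicator_of_mem (show s ∈ Ioi 0 from hs), ← mul_assoc, ← ENNReal.ofReal_mul (by positivity),
      Real.Gamma_add_one ha.ne', add_sub_cancel_right]
    congr 2
    field_simp
  · have h2 : ∀ x, K x s = 0 := by
      intro x
      have : ¬ (0 < x ∧ x < s) := fun h => hs (h.1.trans h.2)
      simp [hK, indicator, this]
    simp [h2, hs]

/-- The sum of finitely many independent standard exponential variables has a gamma law. -/
lemma hasLaw_sum_gammaMeasure {Ω ι : Type*} [MeasurableSpace Ω] {P : Measure Ω}
    [IsProbabilityMeasure P] {X : ι → Ω → ℝ} (hX : ∀ i, HasLaw (X i) (gammaMeasure 1 1) P)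
    (hi : iIndepFun X P) {s : Finset ι} (hs : s.Nonempty) :
    HasLaw (∑ i ∈ s, X i) (gammaMeasure s.card 1) P := by
  classical
  induction hs using Finset.Nonempty.cons_induction with
  | singleton i => simpa using hX i
  | cons i s his hs ih =>
    have hpos : (0 : ℝ) < s.card := by exact_mod_cast hs.card_pos
    have := isProbabilityMeasure_gammaMeasure hpos one_pos
    have := isProbabilityMeasure_gammaMeasure (one_pos (α := ℝ)) one_pos
    have h := IndepFun.hasLaw_add ih (hX i)
      (hi.indepFun_finsetSum_of_notMem₀ (fun i => (hX i).aemeasurable) his)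
    rw [gammaMeasure_conv_one hpos] at h
    rw [Finset.sum_cons, Finset.card_cons, add_comm]
    exact_mod_cast h

/-! ### Circular Gaussians -/

/-- The law of a uniform phase. -/
noncomputable def phaseMeasure : Measure ℝ :=
  ProbabilityTheory.cond volume (Ioo (-Real.pi) Real.pi)

lemma isProbabilityMeasure_phaseMeasure : IsProbabilityMeasure phaseMeasure := by
  refine cond_isProbabilityMeasure_of_finite ?_ ?_ <;> simp [Real.pi_pos]

lemma lintegral_phaseMeasure (F : ℝ → ℝ≥0∞) :
    ∫⁻ θ, F θ ∂phaseMeasure =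
      ENNReal.ofReal (1 / (2 * Real.pi)) * ∫⁻ θ in Ioo (-Real.pi) Real.pi, F θ := by
  rw [phaseMeasure, ProbabilityTheory.cond, lintegral_smul_measure, Real.volume_Ioo,
    ← ENNReal.ofReal_inv_of_pos (by linarith [Real.pi_pos]), smul_eq_mul]
  congr 3
  ring

lemma lintegral_complex_polar {F : ℂ → ℝ≥0∞} (hF : Measurable F) :
    ∫⁻ z, F z = ∫⁻ r in Ioi (0 : ℝ), ∫⁻ θ in Ioo (-Real.pi) Real.pi,
      ENNReal.ofReal r * F (r * Complex.exp (Complex.I * θ)) := by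
  rw [← Complex.lintegral_comp_polarCoord_symm, polarCoord_target, Measure.volume_eq_prod,
    ← Measure.prod_restrict, lintegral_prod]
  · refine lintegral_congr fun r => lintegral_congr fun θ => ?_
    rw [Complex.polarCoord_symm_apply, mul_comm Complex.I, Complex.exp_mul_I, smul_eq_mul]
    simp
  · refine Measurable.aemeasurable ?_
    simp only [Complex.polarCoord_symm_apply, smul_eq_mul]
    fun_prop

lemma lintegral_complex_norm {F : ℝ → ℝ≥0∞} (hF : Measurable F) :
    ∫⁻ z : ℂ, F ‖z‖ =
      ENNReal.ofReal (2 * Real.pi) * ∫⁻ r in Ioi (0 : ℝ), ENNReal.ofReal r * F r := by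
  rw [lintegral_complex_polar (by fun_prop), ← lintegral_const_mul _ (by fun_prop)]
  refine setLIntegral_congr_fun measurableSet_Ioi fun r hr => ?_
  have hr : 0 < r := hr
  have h (θ : ℝ) : ‖(r : ℂ) * Complex.exp (Complex.I * θ)‖ = r := by
    rw [mul_comm Complex.I, norm_mul, Complex.norm_exp_ofReal_mul_I]
    simp [abs_of_pos hr]
  simp only [h, lintegral_const, Measure.restrict_apply_univ, Real.volume_Ioo]
  rw [mul_comm]
  congr 2
  ring

/-- The law of a circular Gaussian with unit variance per real dimension: Rayleigh modulus and
independent uniform phase. -/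
noncomputable def circularGaussian : Measure ℂ :=
  ((rayleighMeasure 1).prod phaseMeasure).map fun p => (p.1 : ℂ) * Complex.exp (Complex.I * p.2)

lemma isProbabilityMeasure_circularGaussian : IsProbabilityMeasure circularGaussian := by
  have := isProbabilityMeasure_rayleighMeasure
  have := isProbabilityMeasure_phaseMeasure
  exact Measure.isProbabilityMeasure_map (by fun_prop)

/-- The factor `r` of the Rayleigh density is exactly the polar Jacobian, and the uniform phase
supplies `1 / (2π)`. -/
lemma circularGaussian_eq_withDensity : circularGaussian = volume.withDensity fun z : ℂ =>
    ENNReal.ofReal (1 / (2 * Real.pi) * Real.exp (-‖z‖ ^ 2 / 2)) := by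
  have := isProbabilityMeasure_rayleighMeasure
  have := isProbabilityMeasure_phaseMeasure
  refine Measure.ext_of_lintegral _ fun F hF => ?_
  rw [circularGaussian, lintegral_map hF (by fun_prop), lintegral_prod _ (by fun_prop),
    lintegral_withDensity_eq_lintegral_mul _ (by fun_prop) hF, lintegral_complex_polar
    (by fun_prop)]
  simp only [lintegral_phaseMeasure]
  rw [lintegral_rayleighMeasure (by
    refine Measurable.const_mul ?_ _
    exact Measurable.lintegral_prod_right' (f := fun p : ℝ × ℝ =>
      F ((p.1 : ℂ) * Complex.exp (Complex.I * p.2))) (by fun_prop))]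
  refine setLIntegral_congr_fun measurableSet_Ioi fun r hr => ?_
  have hr : 0 < r := hr
  have h (θ : ℝ) : ‖(r : ℂ) * Complex.exp (Complex.I * θ)‖ = r := by
    rw [mul_comm Complex.I, norm_mul, Complex.norm_exp_ofReal_mul_I]
    simp [abs_of_pos hr]
  simp only [Pi.mul_apply, h]
  rw [lintegral_const_mul _ (by fun_prop), lintegral_const_mul _ (by fun_prop), ← mul_assoc,
    ← mul_assoc, ← ENNReal.ofReal_mul (by positivity), ← ENNReal.ofReal_mul (by positivity)]
  congr 2
  ring

lemma charFun_circularGaussian (t : ℂ) :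
    charFun circularGaussian t = Complex.exp (-(‖t‖ ^ 2 / 2 : ℝ)) := by
  rw [charFun_apply, circularGaussian_eq_withDensity,
    integral_withDensity_eq_integral_toReal_smul (by fun_prop) (by simp)]
  have h := GaussianFourier.integral_cexp_neg_mul_sq_norm_add (V := ℂ) (b := 1 / 2) (by norm_num) Complex.I t
  calc _ = ∫ z : ℂ, (1 / (2 * Real.pi) : ℂ) *
        Complex.exp (-(1 / 2) * (‖z‖ : ℂ) ^ 2 + Complex.I * (inner ℝ t z : ℝ)) := by
        refine integral_congr_ae (Eventually.of_forall fun z => ?_)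
        simp only
        rw [ENNReal.toReal_ofReal (by positivity), real_inner_comm, Complex.exp_add,
          Complex.real_smul]
        push_cast
        rw [mul_assoc, mul_comm Complex.I]
        congr 3
        ring
    _ = _ := by
        rw [integral_const_mul, h]
        have : (Real.pi : ℂ) ≠ 0 := by exact_mod_cast Real.pi_ne_zero
        simp
        field_simp
        congr 1
        ring

/-- A real linear combination of independent circular Gaussians is a scaled circular Gaussian. -/
lemma map_sum_circularGaussian {ι : Type*} [Fintype ι] (c : ι → ℝ) :
    (Measure.pi fun _ : ι => circularGaussian).map (fun w => ∑ i, c i • w i) =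
      circularGaussian.map (fun w => √(∑ i, c i ^ 2) • w) := by
  have := isProbabilityMeasure_circularGaussian
  have (i : ι) : IsProbabilityMeasure (circularGaussian.map (fun w => c i • w)) :=
    Measure.isProbabilityMeasure_map (by fun_prop)
  have : IsProbabilityMeasure (circularGaussian.map (fun w => √(∑ i, c i ^ 2) • w)) :=
    Measure.isProbabilityMeasure_map (by fun_prop)
  have h1 : (Measure.pi fun _ : ι => circularGaussian).map (fun w => ∑ i, c i • w i) =
      (Measure.pi fun i : ι => circularGaussian.map (fun w => c i • w)).map
        (fun w => ∑ i, w i) := by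
    rw [← Measure.pi_map_pi (fun i => by fun_prop), Measure.map_map (by fun_prop) (by fun_prop)]
    rfl
  rw [h1]
  have : IsProbabilityMeasure ((Measure.pi fun i : ι => circularGaussian.map
      (fun w => c i • w)).map (fun w => ∑ i, w i)) :=
    Measure.isProbabilityMeasure_map (by fun_prop)
  -- The factors `exp (-(c i ^ 2 * ‖t‖ ^ 2) / 2)` multiply to one exponential, in which only `∑ c i
  -- ^ 2` enters.
  refine Measure.ext_of_charFun ?_
  rw [charFun_map_sum_pi_eq_prod]
  ext t
  simp only [Finset.prod_apply, charFun_map_smul, charFun_circularGaussian]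
  rw [← Complex.exp_sum, norm_smul, mul_pow, Real.norm_eq_abs, sq_abs, Real.sq_sqrt (by positivity)]
  congr 1
  simp [mul_pow, Finset.sum_mul, Finset.sum_div]

/-- Separates the moduli from the phases, the form in which they enter `gain`. -/
lemma pi_circularGaussian (ι : Type*) [Fintype ι] :
    (Measure.pi fun _ : ι => circularGaussian) =
      ((Measure.pi fun _ : ι => rayleighMeasure 1).prod (Measure.pi fun _ : ι => phaseMeasure)).map
        (fun p i => (p.1 i : ℂ) * Complex.exp (Complex.I * p.2 i)) := by
  have := isProbabilityMeasure_rayleighMeasure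
  have := isProbabilityMeasure_phaseMeasure
  have := isProbabilityMeasure_circularGaussian
  have h := measurePreserving_arrowProdEquivProdArrow ℝ ℝ ι (fun _ => rayleighMeasure 1)
    (fun _ => phaseMeasure)
  rw [← h.map_eq, Measure.map_map (by fun_prop) (by fun_prop)]
  unfold circularGaussian
  rw [← Measure.pi_map_pi (fun i => by fun_prop)]
  rfl

/-! ### The law of the combining gain -/

/-- Given the amplitudes `c`, the combining gain is distributed like `∑ cₗ²` times the square of a
Rayleigh variable. -/
lemma map_gain_of_amplitudes {L : ℕ} (c : Fin L → ℝ) :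
    ((Measure.pi fun _ : Fin L => rayleighMeasure 1).prod
      (Measure.pi fun _ : Fin L => phaseMeasure)).map (fun p => gain p.1 c p.2) =
      (rayleighMeasure 1).map (fun r => (∑ l, c l ^ 2) * r ^ 2) := by
  have := isProbabilityMeasure_rayleighMeasure
  have := isProbabilityMeasure_phaseMeasure
  have h := congrArg (Measure.map fun z : ℂ => ‖z‖ ^ 2) (map_sum_circularGaussian c)
  rw [pi_circularGaussian, circularGaussian] at h
  simp only [Measure.map_map (by fun_prop : Measurable fun z : ℂ => ‖z‖ ^ 2)
    (by fun_prop : Measurable fun w : Fin L → ℂ => ∑ i, c i • w i)] at h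
  rw [Measure.map_map (by fun_prop) (by fun_prop), Measure.map_map (by fun_prop) (by fun_prop),
    Measure.map_map (by fun_prop) (by fun_prop)] at h
  convert h using 1
  · congr 1
    ext p
    simp only [gain, Function.comp, Complex.real_smul]
    congr 3 with l
    push_cast
    ring
  · have hfst := (measurePreserving_fst (μ := rayleighMeasure 1) (ν := phaseMeasure)).map_eq
    conv_lhs => rw [← hfst]
    rw [Measure.map_map (by fun_prop) (by fun_prop)]
    congr 1
    ext p
    simp only [Function.comp, norm_smul, mul_comm Complex.I, norm_mul,
      Complex.norm_exp_ofReal_mul_I, Complex.norm_real, mul_one, mul_pow, Real.norm_eq_abs, sq_abs]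
    rw [Real.sq_sqrt (by positivity)]

/-- Allows `h` to be the conditioned family, although `map_gain_of_amplitudes` fixes the second
argument of `gain`. -/
lemma gain_comm {L : ℕ} (h g ε : Fin L → ℝ) : gain h g ε = gain g h ε := by
  simp only [gain, mul_comm (h _)]

lemma measurable_gain {α : Type*} [MeasurableSpace α] {L : ℕ} {h g ε : α → Fin L → ℝ}
    (hh : Measurable h) (hg : Measurable g) (hε : Measurable ε) :
    Measurable fun a => gain (h a) (g a) (ε a) := by
  unfold gain
  fun_prop

/-- The joint law of the amplitudes and of the phase errors. -/
noncomputable def channelMeasure (L : ℕ) : Measure (Fin L ⊕ Fin L ⊕ Fin L → ℝ) :=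
  Measure.pi (Sum.elim (fun _ => rayleighMeasure 1)
    (Sum.elim (fun _ => rayleighMeasure 1) fun _ => phaseMeasure))

lemma hasLaw_sum_sq_half (L : ℕ) (hL : 1 ≤ L) :
    HasLaw (fun h : Fin L → ℝ => ∑ l, h l ^ 2 / 2) (gammaMeasure L 1)
      (Measure.pi fun _ : Fin L => rayleighMeasure 1) := by
  have := isProbabilityMeasure_rayleighMeasure
  have hX (i : Fin L) : HasLaw (fun h : Fin L → ℝ => h i ^ 2 / 2) (gammaMeasure 1 1)
      (Measure.pi fun _ : Fin L => rayleighMeasure 1) := by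
    have h1 : HasLaw (fun r : ℝ => r ^ 2 / 2) (gammaMeasure 1 1) (rayleighMeasure 1) :=
      ⟨by fun_prop, map_sq_half_rayleighMeasure⟩
    exact h1.fun_comp (measurePreserving_eval (fun _ : Fin L => rayleighMeasure 1) i).hasLaw
  have hi : iIndepFun (fun (i : Fin L) (h : Fin L → ℝ) => h i ^ 2 / 2)
      (Measure.pi fun _ : Fin L => rayleighMeasure 1) :=
    iIndepFun_pi (X := fun _ r => r ^ 2 / 2) (fun _ => by fun_prop)
  have : Nonempty (Fin L) := ⟨⟨0, hL⟩⟩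
  have := hasLaw_sum_gammaMeasure hX hi (s := Finset.univ) Finset.univ_nonempty
  rw [Finset.card_univ, Fintype.card_fin] at this
  convert this using 1
  ext h
  simp

/-- The combining gain is distributed like `4 T E` with `T` gamma distributed of shape `L` and `E`
an independent standard exponential variable. -/
lemma map_gain_channelMeasure (L : ℕ) (hL : 1 ≤ L) :
    (channelMeasure L).map (fun x => gain (fun l => x (.inl l)) (fun l => x (.inr (.inl l)))
      fun l => x (.inr (.inr l))) =
    ((gammaMeasure L 1).prod (gammaMeasure 1 1)).map fun p => 4 * p.1 * p.2 := by
  have := isProbabilityMeasure_rayleighMeasure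
  have := isProbabilityMeasure_phaseMeasure
  have := isProbabilityMeasure_gammaMeasure (one_pos (α := ℝ)) one_pos
  have := isProbabilityMeasure_gammaMeasure (show (0 : ℝ) < L by exact_mod_cast hL) one_pos
  set ν : Fin L ⊕ Fin L ⊕ Fin L → Measure ℝ := Sum.elim (fun _ => rayleighMeasure 1)
    (Sum.elim (fun _ => rayleighMeasure 1) fun _ => phaseMeasure) with hν
  have (i : Fin L ⊕ Fin L ⊕ Fin L) : IsProbabilityMeasure (ν i) := by
    rcases i with i | i | i <;> simp only [hν, Sum.elim_inl, Sum.elim_inr] <;> infer_instance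
  have e1 := measurePreserving_sumPiEquivProdPi (X := fun _ => ℝ) ν
  have e2 := measurePreserving_sumPiEquivProdPi (X := fun _ => ℝ)
    (fun i : Fin L ⊕ Fin L => ν (.inr i))
  refine Measure.ext_of_lintegral _ fun F hF => ?_
  have hm : Measurable fun q : (Fin L → ℝ) × (Fin L → ℝ) × (Fin L → ℝ) =>
      F (gain q.1 q.2.1 q.2.2) :=
    hF.comp (measurable_gain measurable_fst measurable_snd.fst measurable_snd.snd)
  have e := (MeasurePreserving.id (Measure.pi fun l : Fin L => ν (.inl l))).prod e2 |>.comp e1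
  have h1 : ∫⁻ x, F (gain (fun l => x (.inl l)) (fun l => x (.inr (.inl l)))
      fun l => x (.inr (.inr l))) ∂channelMeasure L =
      ∫⁻ h, ∫⁻ q, F (gain h q.1 q.2) ∂((Measure.pi fun _ : Fin L => rayleighMeasure 1).prod
      (Measure.pi fun _ : Fin L => phaseMeasure)) ∂(Measure.pi fun _ : Fin L => rayleighMeasure 1) := by
    have := e.lintegral_comp hm
    rw [lintegral_prod _ hm.aemeasurable] at this
    exact this
  have h2 (h : Fin L → ℝ) : ∫⁻ q, F (gain h q.1 q.2)
      ∂((Measure.pi fun _ : Fin L => rayleighMeasure 1).prod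
      (Measure.pi fun _ : Fin L => phaseMeasure)) =
      ∫⁻ s, F (4 * (∑ l, h l ^ 2 / 2) * s) ∂gammaMeasure 1 1 := by
    simp only [gain_comm h]
    rw [← lintegral_map (f := F) hF (measurable_gain measurable_fst measurable_const measurable_snd),
      map_gain_of_amplitudes, lintegral_map hF (by fun_prop), ← map_sq_half_rayleighMeasure,
      lintegral_map (by fun_prop) (by fun_prop)]
    refine lintegral_congr fun r => ?_
    rw [← Finset.sum_div]
    congr 1
    ring
  rw [lintegral_map hF (measurable_gain (by fun_prop) (by fun_prop) (by fun_prop)), h1]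
  simp only [h2]
  rw [lintegral_map hF (by fun_prop), lintegral_prod _ (by fun_prop),
    ← (hasLaw_sum_sq_half L hL).map_eq, lintegral_map _ (by fun_prop)]
  exact Measurable.lintegral_prod_right' (f := fun p : ℝ × ℝ => F (4 * p.1 * p.2)) (by fun_prop)

/-! ### The uniform point of the ring -/

lemma lintegral_euclidean_norm {F : ℝ → ℝ≥0∞} (hF : Measurable F) :
    ∫⁻ x : EuclideanSpace ℝ (Fin 2), F ‖x‖ =
      ENNReal.ofReal (2 * Real.pi) * ∫⁻ r in Ioi (0 : ℝ), ENNReal.ofReal r * F r := by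
  rw [← lintegral_complex_norm hF,
    ← Complex.orthonormalBasisOneI.measurePreserving_repr.lintegral_comp (by fun_prop)]
  simp

lemma setLIntegral_planarRing (c : EuclideanSpace ℝ (Fin 2)) {R₁ R₂ : ℝ} (hR₁ : 0 ≤ R₁)
    {F : ℝ → ℝ≥0∞} (hF : Measurable F) :
    ∫⁻ x in planarRing c R₁ R₂, F (dist x c) =
      ENNReal.ofReal (2 * Real.pi) * ∫⁻ r in Icc R₁ R₂, ENNReal.ofReal r * F r := by
  have hring : planarRing c R₁ R₂ = (fun x => dist x c) ⁻¹' Icc R₁ R₂ := rfl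
  rw [← lintegral_indicator (by rw [hring]; exact measurableSet_Icc.preimage (by fun_prop))]
  have h1 (x : EuclideanSpace ℝ (Fin 2)) :
      (planarRing c R₁ R₂).indicator (fun x => F (dist x c)) x =
        (Icc R₁ R₂).indicator F ‖x - c‖ := by
    rw [← dist_eq_norm]
    rfl
  simp only [h1]
  rw [lintegral_sub_right_eq_self (fun x => (Icc R₁ R₂).indicator F ‖x‖) c,
    lintegral_euclidean_norm (hF.indicator measurableSet_Icc),
    ← setLIntegral_congr (s := Ici 0) Ioi_ae_eq_Ici.symm, ← lintegral_indicator measurableSet_Ici,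
    ← lintegral_indicator measurableSet_Icc]
  congr 1
  refine lintegral_congr fun r => ?_
  by_cases hr : r ∈ Icc R₁ R₂
  · simp [hr, hR₁.trans hr.1]
  · simp [hr, indicator]

lemma volume_planarRing (c : EuclideanSpace ℝ (Fin 2)) {R₁ R₂ : ℝ} (hR₁ : 0 ≤ R₁)
    (hR : R₁ < R₂) :
    volume (planarRing c R₁ R₂) = ENNReal.ofReal (Real.pi * (R₂ ^ 2 - R₁ ^ 2)) := by
  have h := setLIntegral_planarRing c (R₂ := R₂) hR₁ (F := fun _ => 1) measurable_const
  rw [lintegral_const, one_mul, Measure.restrict_apply_univ] at h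
  rw [h]
  simp only [mul_one]
  rw [← ofReal_integral_eq_lintegral_ofReal, integral_Icc_eq_integral_Ioc,
    ← intervalIntegral.integral_of_le hR.le, integral_id, ← ENNReal.ofReal_mul (by positivity)]
  · congr 1
    ring
  · exact (continuous_id.integrableOn_Icc)
  · filter_upwards [self_mem_ae_restrict measurableSet_Icc] with x hx
    exact hR₁.trans hx.1

/-- Density of the distance from the centre of a uniform point of a planar ring. -/
noncomputable def ringPDF (R₁ R₂ r : ℝ) : ℝ :=
  if R₁ ≤ r ∧ r ≤ R₂ then 2 * r / (R₂ ^ 2 - R₁ ^ 2) else 0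

lemma measurable_ringPDF (R₁ R₂ : ℝ) : Measurable (ringPDF R₁ R₂) :=
  Measurable.ite measurableSet_Icc (by fun_prop) measurable_const

lemma lintegral_withDensity_ringPDF {R₁ R₂ : ℝ} {F : ℝ → ℝ≥0∞} (hF : Measurable F) :
    ∫⁻ r, F r ∂(volume.withDensity fun r => ENNReal.ofReal (ringPDF R₁ R₂ r)) =
      ∫⁻ r in Icc R₁ R₂, ENNReal.ofReal (2 * r / (R₂ ^ 2 - R₁ ^ 2)) * F r := by
  rw [lintegral_withDensity_eq_lintegral_mul _ (measurable_ringPDF R₁ R₂).ennreal_ofReal hF,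
    ← lintegral_indicator measurableSet_Icc]
  refine lintegral_congr fun r => ?_
  by_cases h : R₁ ≤ r ∧ r ≤ R₂ <;> simp [ringPDF, indicator, h]

lemma map_dist_cond_planarRing (c : EuclideanSpace ℝ (Fin 2)) {R₁ R₂ : ℝ} (hR₁ : 0 ≤ R₁)
    (hR : R₁ < R₂) :
    (ProbabilityTheory.cond volume (planarRing c R₁ R₂)).map (fun x => dist x c) =
      volume.withDensity fun r => ENNReal.ofReal (ringPDF R₁ R₂ r) := by
  have hpos : 0 < R₂ ^ 2 - R₁ ^ 2 := by nlinarith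
  have hπ := Real.pi_pos
  refine Measure.ext_of_lintegral _ fun F hF => ?_
  rw [lintegral_map hF (by fun_prop), ProbabilityTheory.cond, lintegral_smul_measure,
    setLIntegral_planarRing c hR₁ hF, volume_planarRing c hR₁ hR, lintegral_withDensity_ringPDF hF,
    ← ENNReal.ofReal_inv_of_pos (by positivity), smul_eq_mul, ← mul_assoc,
    ← ENNReal.ofReal_mul (by positivity), ← lintegral_const_mul _ (by fun_prop)]
  refine setLIntegral_congr_fun measurableSet_Icc fun r hr => ?_
  rw [← mul_assoc, ← ENNReal.ofReal_mul (by positivity)]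
  congr 2
  field_simp

/-! ### The Bessel kernel and the law of `4 T E` -/

/-- The kernel `∫₀^∞ t ^ (a - 2) exp (-t - z / t) dt`, which is `2 z ^ ((a - 1) / 2) K_{a-1}(2 √z)`. -/
noncomputable def besselKernel (a z : ℝ) : ℝ :=
  ∫ t in Ioi (0 : ℝ), t ^ (a - 2) * Real.exp (-t - z / t)

/-- Gains one power of `t` near `0`, so that the kernel converges for all `a > 0`. This covers `a =
1`, that is `L = 1`, where `t ^ (a - 2)` alone is not integrable at `0`. -/
lemma exp_neg_div_le {z t : ℝ} (hz : 0 < z) (ht : 0 < t) : Real.exp (-(z / t)) ≤ t / z := by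
  rw [Real.exp_neg, ← inv_div z t]
  exact inv_anti₀ (by positivity) (by linarith [Real.add_one_le_exp (z / t)])

lemma integrableOn_besselKernel {a z : ℝ} (ha : 0 < a) (hz : 0 < z) :
    IntegrableOn (fun t : ℝ => t ^ (a - 2) * Real.exp (-t - z / t)) (Ioi 0) := by
  refine Integrable.mono' ((Real.GammaIntegral_convergent ha).const_mul z⁻¹)
    (by fun_prop) ?_
  filter_upwards [self_mem_ae_restrict measurableSet_Ioi] with t ht
  have ht : 0 < t := ht
  rw [Real.norm_of_nonneg (by positivity), sub_eq_add_neg (-t), Real.exp_add,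
    show a - 1 = (a - 2) + 1 by ring, Real.rpow_add_one ht.ne']
  have h1 := exp_neg_div_le hz ht
  calc t ^ (a - 2) * (Real.exp (-t) * Real.exp (-(z / t)))
      ≤ t ^ (a - 2) * (Real.exp (-t) * (t / z)) := by gcongr
    _ = _ := by ring

lemma besselKernel_nonneg (a z : ℝ) : 0 ≤ besselKernel a z :=
  setIntegral_nonneg measurableSet_Ioi fun _ ht =>
    mul_nonneg (Real.rpow_nonneg (le_of_lt ht) _) (Real.exp_pos _).le

lemma lintegral_besselKernel {a z : ℝ} (ha : 0 < a) (hz : 0 < z) :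
    ∫⁻ t in Ioi (0 : ℝ), ENNReal.ofReal (t ^ (a - 2) * Real.exp (-t - z / t)) =
      ENNReal.ofReal (besselKernel a z) := by
  rw [besselKernel, ofReal_integral_eq_lintegral_ofReal (integrableOn_besselKernel ha hz)]
  filter_upwards [self_mem_ae_restrict measurableSet_Ioi] with t ht
  exact mul_nonneg (Real.rpow_nonneg (le_of_lt ht) _) (Real.exp_pos _).le

lemma measurable_besselKernel (a : ℝ) : Measurable (besselKernel a) := by
  unfold besselKernel
  refine StronglyMeasurable.measurable ?_
  refine StronglyMeasurable.integral_prod_right'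
    (f := fun p : ℝ × ℝ => p.2 ^ (a - 2) * Real.exp (-p.2 - p.1 / p.2)) ?_
  exact Measurable.stronglyMeasurable (by fun_prop)

lemma lintegral_Ioi_comp_mul_left {c : ℝ} (hc : 0 < c) (F : ℝ → ℝ≥0∞) :
    ∫⁻ x in Ioi (0 : ℝ), F x = ∫⁻ x in Ioi (0 : ℝ), ENNReal.ofReal c * F (c * x) := by
  have himg : (fun x : ℝ => c * x) '' Ioi 0 = Ioi 0 := by
    rw [image_mul_left_Ioi hc, mul_zero]
  have key := lintegral_image_eq_lintegral_abs_deriv_mul (f' := fun _ => c) (f := fun x => c * x)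
    measurableSet_Ioi
    (fun x _ => by simpa using ((hasDerivAt_id x).const_mul c).hasDerivWithinAt (s := Ioi 0))
    (mul_right_injective₀ hc.ne').injOn F
  rw [himg, abs_of_pos hc] at key
  exact key

/-- The law of `4 T E` has a density given by the Bessel kernel. -/
lemma lintegral_four_mul_gamma_exp {a : ℝ} (ha : 0 < a) {F : ℝ → ℝ≥0∞} (hF : Measurable F) :
    ∫⁻ p, F (4 * p.1 * p.2) ∂((gammaMeasure a 1).prod (gammaMeasure 1 1)) =
      ∫⁻ x in Ioi 0, ENNReal.ofReal (besselKernel a (x / 4) / (4 * Real.Gamma a)) * F x := by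
  have := isProbabilityMeasure_gammaMeasure (one_pos (α := ℝ)) one_pos
  have := isProbabilityMeasure_gammaMeasure ha one_pos
  have hΓ := Real.Gamma_pos_of_pos ha
  rw [lintegral_prod _ (by fun_prop), lintegral_gammaMeasure a
    (Measurable.lintegral_prod_right' (f := fun p : ℝ × ℝ => F (4 * p.1 * p.2)) (by fun_prop))]
  have h1 : ∀ t ∈ Ioi (0 : ℝ), ENNReal.ofReal (t ^ (a - 1) * Real.exp (-t) / Real.Gamma a) *
      ∫⁻ s, F (4 * t * s) ∂gammaMeasure 1 1 =
      ∫⁻ x in Ioi (0 : ℝ), ENNReal.ofReal (t ^ (a - 2) * Real.exp (-t - x / 4 / t)) *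
        (ENNReal.ofReal (1 / (4 * Real.Gamma a)) * F x) := by
    intro t ht
    have ht : 0 < t := ht
    -- Substitution `x = 4 t s` at fixed `t`; its Jacobian lowers the exponent of `t` from `a - 1`
    -- to `a - 2`.
    rw [lintegral_gammaMeasure 1 (by fun_prop), ← lintegral_const_mul _ (by fun_prop),
      lintegral_Ioi_comp_mul_left (c := 4 * t) (by positivity) fun x => ENNReal.ofReal
        (t ^ (a - 2) * Real.exp (-t - x / 4 / t)) * (ENNReal.ofReal (1 / (4 * Real.Gamma a)) * F x)]
    refine setLIntegral_congr_fun measurableSet_Ioi fun s hs => ?_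
    have hs : 0 < s := hs
    simp only [← mul_assoc]
    rw [← ENNReal.ofReal_mul (by positivity), ← ENNReal.ofReal_mul (by positivity),
      ← ENNReal.ofReal_mul (by positivity)]
    congr 2
    rw [show a - 1 = (a - 2) + 1 by ring, Real.rpow_add_one ht.ne',
      show 4 * t * s / 4 / t = s by field_simp, sub_eq_add_neg (-t), Real.exp_add]
    simp
    field_simp
  rw [setLIntegral_congr_fun measurableSet_Ioi h1, lintegral_lintegral_swap (by fun_prop)]
  refine setLIntegral_congr_fun measurableSet_Ioi fun x hx => ?_
  have hx : 0 < x := hx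
  rw [lintegral_mul_const _ (by fun_prop), lintegral_besselKernel ha (by positivity), ← mul_assoc,
    ← ENNReal.ofReal_mul (besselKernel_nonneg _ _), mul_one_div]

lemma gammaMeasure_one_Ioi {x : ℝ} (hx : 0 ≤ x) :
    gammaMeasure 1 1 (Ioi x) = ENNReal.ofReal (Real.exp (-x)) := by
  rw [← lintegral_indicator_one measurableSet_Ioi,
    lintegral_gammaMeasure 1 (measurable_one.indicator measurableSet_Ioi)]
  have h : ∀ s ∈ Ioi (0 : ℝ), ENNReal.ofReal (s ^ ((1 : ℝ) - 1) * Real.exp (-s) / Real.Gamma 1) *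
      (Ioi x).indicator 1 s = (Ioi x).indicator (fun s => ENNReal.ofReal (Real.exp (-s))) s := by
    intro s _
    by_cases hs : x < s <;> simp [indicator, hs]
  rw [setLIntegral_congr_fun measurableSet_Ioi h, setLIntegral_indicator measurableSet_Ioi,
    inter_eq_left.2 (Ioi_subset_Ioi hx), ← ofReal_integral_eq_lintegral_ofReal,
    integral_exp_neg_Ioi]
  · exact integrableOn_exp_neg_Ioi x
  · exact Eventually.of_forall fun s => (Real.exp_pos _).le

/-- Given `T = t`, the tail is `exp (-x / (4 t))`. No Jacobian occurs here, so the index is one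
higher than in the density. -/
lemma measure_four_mul_gamma_exp_gt {a x : ℝ} (ha : 0 < a) (hx : 0 < x) :
    ((gammaMeasure a 1).prod (gammaMeasure 1 1)) {p | x < 4 * p.1 * p.2} =
      ENNReal.ofReal (besselKernel (a + 1) (x / 4) / Real.Gamma a) := by
  have := isProbabilityMeasure_gammaMeasure (one_pos (α := ℝ)) one_pos
  have := isProbabilityMeasure_gammaMeasure ha one_pos
  have hΓ := Real.Gamma_pos_of_pos ha
  have hs : MeasurableSet {p : ℝ × ℝ | x < 4 * p.1 * p.2} :=
    measurableSet_lt measurable_const (by fun_prop)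
  rw [Measure.prod_apply hs, lintegral_gammaMeasure a (measurable_measure_prodMk_left hs)]
  have h1 : ∀ t ∈ Ioi (0 : ℝ), ENNReal.ofReal (t ^ (a - 1) * Real.exp (-t) / Real.Gamma a) *
      gammaMeasure 1 1 (Prod.mk t ⁻¹' {p | x < 4 * p.1 * p.2}) =
      ENNReal.ofReal (t ^ ((a + 1) - 2) * Real.exp (-t - x / 4 / t)) *
        ENNReal.ofReal (1 / Real.Gamma a) := by
    intro t ht
    have ht : 0 < t := ht
    have : Prod.mk t ⁻¹' {p | x < 4 * p.1 * p.2} = Ioi (x / 4 / t) := by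
      ext s
      simp only [mem_preimage, mem_ofPred_eq, mem_Ioi, div_div]
      rw [div_lt_iff₀ (by positivity), mul_comm]
    rw [this, gammaMeasure_one_Ioi (by positivity), ← ENNReal.ofReal_mul (by positivity),
      ← ENNReal.ofReal_mul (by positivity), sub_eq_add_neg (-t), Real.exp_add,
      show a + 1 - 2 = a - 1 by ring]
    congr 1
    ring
  rw [setLIntegral_congr_fun measurableSet_Ioi h1, lintegral_mul_const _ (by fun_prop),
    lintegral_besselKernel (by linarith) (by positivity),
    ← ENNReal.ofReal_mul (besselKernel_nonneg _ _), mul_one_div]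

/-- Substituting `t = √z e ^ u` turns `t + z / t` into `2 √z cosh u`; averaging over `u` and `-u`
then turns `e ^ (ν u)` into `cosh (ν u)`. -/
lemma besselKernel_eq_besselK {ν z : ℝ} (hν : 0 < ν) (hz : 0 < z) :
    besselKernel (ν + 1) z = 2 * √z ^ ν * besselK ν (2 * √z) := by
  have hw : 0 < √z := Real.sqrt_pos.2 hz
  have hzw : z = √z * √z := (Real.mul_self_sqrt hz.le).symm
  have himg : (fun u : ℝ => √z * Real.exp u) '' univ = Ioi 0 := by
    ext y
    simp only [image_univ, mem_range, mem_Ioi]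
    constructor
    · rintro ⟨u, rfl⟩; positivity
    · intro hy
      exact ⟨Real.log (y / √z), by rw [Real.exp_log (by positivity)]; field_simp⟩
  have hderiv : ∀ u ∈ (univ : Set ℝ),
      HasDerivWithinAt (fun u : ℝ => √z * Real.exp u) (√z * Real.exp u) univ u :=
    fun u _ => ((Real.hasDerivAt_exp u).const_mul _).hasDerivWithinAt
  have hinj : InjOn (fun u : ℝ => √z * Real.exp u) univ := by
    intro u _ v _ h
    exact Real.exp_injective (mul_left_cancel₀ hw.ne' h)
  set G : ℝ → ℝ := fun t => t ^ (ν + 1 - 2) * Real.exp (-t - z / t) with hG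
  set f : ℝ → ℝ := fun u => Real.exp (ν * u) * Real.exp (-(2 * √z) * Real.cosh u) with hf
  have hcongr (u : ℝ) : |√z * Real.exp u| • G (√z * Real.exp u) = √z ^ ν * f u := by
    have hpos : 0 < √z * Real.exp u := by positivity
    simp only [hG, hf, smul_eq_mul, abs_of_pos hpos]
    have e1 : z / (√z * Real.exp u) = √z * Real.exp (-u) := by
      rw [Real.exp_neg]
      nth_rewrite 1 [hzw]
      field_simp
    rw [e1, Real.cosh_eq, ← mul_assoc, ← Real.rpow_one_add' hpos.le (by linarith),
      show 1 + (ν + 1 - 2) = ν by ring, Real.mul_rpow hw.le (Real.exp_pos _).le, ← Real.exp_mul,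
      mul_assoc, mul_comm u]
    congr 3
    ring
  have hint : Integrable f := by
    have h := (integrableOn_image_iff_integrableOn_abs_deriv_smul MeasurableSet.univ hderiv hinj
      G).1 (by rw [himg]; exact integrableOn_besselKernel (by linarith) hz)
    simp only [hcongr, integrableOn_univ] at h
    have := h.const_mul (√z ^ ν)⁻¹
    have hne : √z ^ ν ≠ 0 := (Real.rpow_pos_of_pos hw _).ne'
    simpa [← mul_assoc, inv_mul_cancel₀ hne] using this
  have h := integral_image_eq_integral_abs_deriv_smul MeasurableSet.univ hderiv hinj G
  simp only [himg, hcongr, Measure.restrict_univ] at h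
  rw [besselKernel, h, integral_const_mul]
  have hsymm : ∫ u, f u = ∫ u, Real.exp (-(2 * √z) * Real.cosh |u|) * Real.cosh (ν * |u|) := by
    have h2 : ∫ u, f u = ∫ u, (f u + f (-u)) / 2 := by
      rw [integral_div, integral_add hint hint.comp_neg, integral_neg_eq_self]
      ring
    rw [h2]
    refine integral_congr_ae (Eventually.of_forall fun u => ?_)
    have e : Real.cosh (ν * |u|) = Real.cosh (ν * u) := by
      rcases abs_choice u with h | h <;> rw [h]
      rw [mul_neg, Real.cosh_neg]
    simp only [hf, Real.cosh_abs, e, Real.cosh_neg, Real.cosh_eq (ν * u), mul_neg]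
    ring
  rw [hsymm, integral_comp_abs (f := fun u => Real.exp (-(2 * √z) * Real.cosh u) *
    Real.cosh (ν * u)), besselK]
  ring

/-! ### Mellin transforms of the kernel and its average -/

/-- By Fubini, the `z`-integral of `z ^ (s - 1) exp (-z / t)` is `Γ(s) t ^ s`, and the remaining
`t`-integral is the Gamma integral at `s + a - 1`. -/
lemma hasMellin_besselKernel {a : ℝ} {s : ℂ} (hs : 0 < s.re) (hsa : 0 < s.re + a - 1) :
    HasMellin (fun z => (besselKernel a z : ℂ)) s (Complex.Gamma s * Complex.Gamma (s + a - 1)) := by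
  set H : ℝ → ℝ → ℂ := fun z t =>
    (z : ℂ) ^ (s - 1) * ((t ^ (a - 2) * Real.exp (-t - z / t) : ℝ) : ℂ) with hH
  have hHm : Measurable (Function.uncurry H) := by
    simp only [hH, Function.uncurry_def]
    fun_prop
  have hsplit (z t : ℝ) : t ^ (a - 2) * Real.exp (-t - z / t) =
      t ^ (a - 2) * Real.exp (-t) * Real.exp (-(1 / t * z)) := by
    rw [sub_eq_add_neg (-t), Real.exp_add, mul_assoc]
    congr 4
    ring
  have hnorm {z t : ℝ} (hz : 0 < z) (ht : 0 < t) :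
      ‖H z t‖ = t ^ (a - 2) * Real.exp (-t) * (z ^ (s.re - 1) * Real.exp (-(1 / t * z))) := by
    rw [hH, norm_mul, Complex.norm_cpow_eq_rpow_re_of_pos hz, Complex.norm_real,
      Real.norm_of_nonneg (by positivity), hsplit]
    simp only [Complex.sub_re, Complex.one_re]
    ring
  have hinner {t : ℝ} (ht : 0 < t) : IntegrableOn (fun z => H z t) (Ioi 0) := by
    have h := (integrableOn_rpow_mul_exp_neg_mul_rpow (p := 1) (s := s.re - 1) (b := 1 / t)
      (by linarith) one_pos (by positivity)).const_mul (t ^ (a - 2) * Real.exp (-t))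
    refine h.mono' (hHm.of_uncurry_right).aestronglyMeasurable ?_
    filter_upwards [self_mem_ae_restrict measurableSet_Ioi] with z hz
    rw [hnorm hz ht, Real.rpow_one, neg_mul]
  have hH_int : Integrable (Function.uncurry H)
      ((volume.restrict (Ioi 0)).prod (volume.restrict (Ioi 0))) := by
    refine (integrable_prod_iff' hHm.aestronglyMeasurable).2 ⟨?_, ?_⟩
    · filter_upwards [self_mem_ae_restrict measurableSet_Ioi] with t ht using hinner ht
    · have h := (Real.GammaIntegral_convergent hsa).const_mul (Real.Gamma s.re)
      refine h.congr ?_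
      filter_upwards [self_mem_ae_restrict measurableSet_Ioi] with t ht
      have ht : 0 < t := ht
      simp only [Function.uncurry_apply_pair]
      rw [setIntegral_congr_fun (g := fun z => t ^ (a - 2) * Real.exp (-t) *
        (z ^ (s.re - 1) * Real.exp (-(1 / t * z)))) measurableSet_Ioi fun z hz => hnorm hz ht,
        integral_const_mul,
        Real.integral_rpow_mul_exp_neg_mul_Ioi hs (by positivity), one_div_one_div,
        show s.re + a - 1 - 1 = (a - 2) + s.re by ring, Real.rpow_add ht]
      ring
  have hker (z : ℝ) : ∫ t in Ioi 0, H z t = (z : ℂ) ^ (s - 1) • (besselKernel a z : ℂ) := by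
    rw [hH, integral_const_mul, integral_complex_ofReal, smul_eq_mul, besselKernel]
  constructor
  · have := hH_int.integral_prod_left
    simp only [Function.uncurry_apply_pair, hker] at this
    exact this
  · have h := integral_integral_swap hH_int
    simp only [hker] at h
    rw [mellin, h, Complex.Gamma_eq_integral (s := s + a - 1) (by simpa using hsa),
      Complex.GammaIntegral, ← integral_const_mul]
    refine setIntegral_congr_fun measurableSet_Ioi fun t ht => ?_
    have ht : 0 < t := ht
    have htc : (t : ℂ) ≠ 0 := by exact_mod_cast ht.ne'
    have e (z : ℝ) : H z t = ((t ^ (a - 2) * Real.exp (-t) : ℝ) : ℂ) *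
        ((z : ℂ) ^ (s - 1) * Complex.exp (-((1 / t : ℝ) * z))) := by
      simp only [hH, hsplit]
      push_cast
      ring
    simp only [e]
    rw [integral_const_mul, Complex.integral_cpow_mul_exp_neg_mul_Ioi hs (by positivity)]
    have e2 : (1 / ((1 / t : ℝ) : ℂ)) = t := by
      push_cast
      rw [one_div_one_div]
    rw [e2, show s + a - 1 - 1 = ((a - 2 : ℝ) : ℂ) + s by push_cast; ring,
      Complex.cpow_add _ _ htc, ← Complex.ofReal_cpow ht.le]
    push_cast
    ring

/-- Averaging `f` against a power over `(0, z)` divides the Mellin transform by `β - s`. -/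
lemma hasMellin_rpow_mul_integral {f : ℝ → ℝ} (hf : Measurable f) {β : ℝ} {s : ℂ}
    (hs : s.re < β) (hfs : MellinConvergent (fun z => (f z : ℂ)) s) :
    HasMellin (fun z => ((z ^ (-β) * ∫ v in Ioo 0 z, v ^ (β - 1) * f v : ℝ) : ℂ)) s
      (mellin (fun z => (f z : ℂ)) s / (β - s)) := by
  -- Fubini on `0 < v < z`: the integral of `z ^ (s - 1 - β)` over `z > v` is `v ^ (s - β) / (β -
  -- s)`, convergent because `Re s < β`.
  set H : ℝ → ℝ → ℂ := fun z v => {p : ℝ × ℝ | p.2 < p.1}.indicator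
    (fun p => (p.1 : ℂ) ^ (s - 1 - β) * ((p.2 ^ (β - 1) * f p.2 : ℝ) : ℂ)) (z, v) with hH
  have hset : MeasurableSet {p : ℝ × ℝ | p.2 < p.1} :=
    measurableSet_lt measurable_snd measurable_fst
  have hHm : Measurable (Function.uncurry H) := by
    refine Measurable.indicator ?_ hset
    fun_prop
  have hHv (v z : ℝ) : H z v = (Ioi v).indicator
      (fun z : ℝ => (z : ℂ) ^ (s - 1 - β) * ((v ^ (β - 1) * f v : ℝ) : ℂ)) z := by
    by_cases h : v < z <;> simp [hH, indicator, h]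
  have hHz (z v : ℝ) : H z v = (Iio z).indicator
      (fun v : ℝ => (z : ℂ) ^ (s - 1 - β) * ((v ^ (β - 1) * f v : ℝ) : ℂ)) v := by
    by_cases h : v < z <;> simp [hH, indicator, h]
  have hre : (s - 1 - β).re < -1 := by simp; linarith
  have hpow {v : ℝ} (hv : 0 < v) : IntegrableOn (fun z : ℝ => (z : ℂ) ^ (s - 1 - β)) (Ioi v) :=
    integrableOn_Ioi_cpow_of_lt hre hv
  have hind {v : ℝ} (hv : 0 < v) {E : Type} [NormedAddCommGroup E] [NormedSpace ℝ E] (G : ℝ → E) :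
      ∫ z in Ioi 0, (Ioi v).indicator G z = ∫ z in Ioi v, G z := by
    rw [setIntegral_indicator measurableSet_Ioi, inter_eq_right.2 (Ioi_subset_Ioi hv.le)]
  have hH_int : Integrable (Function.uncurry H)
      ((volume.restrict (Ioi 0)).prod (volume.restrict (Ioi 0))) := by
    refine (integrable_prod_iff' hHm.aestronglyMeasurable).2 ⟨?_, ?_⟩
    · filter_upwards [self_mem_ae_restrict measurableSet_Ioi] with v hv
      simp only [Function.uncurry_apply_pair, hHv]
      refine IntegrableOn.integrable ?_
      exact (IntegrableOn.integrable_indicator ((hpow hv).mul_const _)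
        measurableSet_Ioi).integrableOn
    · refine (hfs.norm.div_const (β - s.re)).congr ?_
      filter_upwards [self_mem_ae_restrict measurableSet_Ioi] with v hv
      have hv : 0 < v := hv
      simp only [Function.uncurry_apply_pair, hHv, norm_indicator_eq_indicator_norm]
      rw [hind hv]
      have e : ∀ z ∈ Ioi v, ‖(z : ℂ) ^ (s - 1 - β) * ((v ^ (β - 1) * f v : ℝ) : ℂ)‖ =
          z ^ (s.re - 1 - β) * (v ^ (β - 1) * |f v|) := by
        intro z hz
        rw [norm_mul, Complex.norm_cpow_eq_rpow_re_of_pos (hv.trans hz), Complex.norm_real,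
          norm_mul, Real.norm_of_nonneg (Real.rpow_nonneg hv.le _), Real.norm_eq_abs]
        simp
      rw [setIntegral_congr_fun measurableSet_Ioi e, integral_mul_const,
        integral_Ioi_rpow_of_lt (by linarith) hv, norm_smul,
        Complex.norm_cpow_eq_rpow_re_of_pos hv, Complex.norm_real, Real.norm_eq_abs,
        show (s - 1).re = (s.re - 1 - β + 1) + (β - 1) by simp, Real.rpow_add hv,
        show s.re - 1 - β + 1 = -(β - s.re) by ring]
      have : β - s.re ≠ 0 := by linarith
      field_simp
  have hker : ∀ z ∈ Ioi (0 : ℝ), ∫ v in Ioi 0, H z v = (z : ℂ) ^ (s - 1) •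
      ((z ^ (-β) * ∫ v in Ioo 0 z, v ^ (β - 1) * f v : ℝ) : ℂ) := by
    intro z hz
    have hz : 0 < z := hz
    have hzc : (z : ℂ) ≠ 0 := by exact_mod_cast hz.ne'
    simp only [hHz]
    rw [setIntegral_indicator measurableSet_Iio, Ioi_inter_Iio, integral_const_mul,
      integral_complex_ofReal, smul_eq_mul, Complex.ofReal_mul, Complex.ofReal_cpow hz.le,
      ← mul_assoc, ← Complex.cpow_add _ _ hzc]
    congr 3
    push_cast
    ring
  constructor
  · exact IntegrableOn.congr_fun hH_int.integral_prod_left hker measurableSet_Ioi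
  · have h := integral_integral_swap hH_int
    rw [setIntegral_congr_fun measurableSet_Ioi hker] at h
    rw [mellin, h, mellin, ← integral_div]
    refine setIntegral_congr_fun measurableSet_Ioi fun v hv => ?_
    have hv : 0 < v := hv
    have hvc : (v : ℂ) ≠ 0 := by exact_mod_cast hv.ne'
    have e : (v : ℂ) ^ (s - 1) = (v : ℂ) ^ (s - 1 - β + 1) * (v : ℂ) ^ ((β - 1 : ℝ) : ℂ) := by
      rw [← Complex.cpow_add _ _ hvc]
      congr 1
      push_cast
      ring
    simp only [hHv]
    rw [hind hv, integral_mul_const, integral_Ioi_cpow_of_lt hre hv, Complex.ofReal_mul,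
      Complex.ofReal_cpow hv.le, smul_eq_mul, e]
    have h1 : (β : ℂ) - s ≠ 0 := by
      intro h0
      have := congrArg Complex.re h0
      simp at this
      linarith
    rw [show s - 1 - β + 1 = -(β - s) by ring]
    field_simp

/-! ### Decay on vertical lines and Mellin inversion -/

lemma norm_Gamma_le_Gamma_re {s : ℂ} (hs : 0 < s.re) : ‖Complex.Gamma s‖ ≤ Real.Gamma s.re := by
  rw [Complex.Gamma_eq_integral hs, Real.Gamma_eq_integral hs, Complex.GammaIntegral]
  refine (norm_integral_le_integral_norm _).trans_eq ?_
  refine setIntegral_congr_fun measurableSet_Ioi fun t ht => ?_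
  rw [norm_mul, Complex.norm_cpow_eq_rpow_re_of_pos ht, Complex.norm_real,
    Real.norm_of_nonneg (Real.exp_pos _).le]
  simp

/-- From `Γ(s + 2) = (s + 1) s Γ(s)` and `‖s‖ ≤ ‖s + 1‖`. This quadratic decay already suffices for
absolute convergence on vertical lines. -/
lemma norm_Gamma_le_div {s : ℂ} (hs : 0 < s.re) :
    ‖Complex.Gamma s‖ ≤ Real.Gamma (s.re + 2) / (s.re ^ 2 + s.im ^ 2) := by
  have h0 : s ≠ 0 := by rintro rfl; simp at hs
  have h1 : s + 1 ≠ 0 := by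
    intro h
    have := congrArg Complex.re h
    simp at this
    linarith
  have hsq : ‖s‖ ^ 2 = s.re ^ 2 + s.im ^ 2 := by
    rw [Complex.sq_norm, Complex.normSq_apply]; ring
  have hle : ‖s‖ ≤ ‖s + 1‖ := by
    refine (pow_le_pow_iff_left₀ (norm_nonneg _) (norm_nonneg _) two_ne_zero).1 ?_
    rw [hsq, Complex.sq_norm, Complex.normSq_apply]
    simp
    nlinarith
  have hb := norm_Gamma_le_Gamma_re (s := s + 1 + 1) (by simp; linarith)
  rw [Complex.Gamma_add_one _ h1, Complex.Gamma_add_one _ h0, norm_mul, norm_mul] at hb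
  have hpos : 0 < ‖s‖ := norm_pos_iff.2 h0
  rw [← hsq, le_div_iff₀ (by positivity)]
  have e : (s + 1 + 1).re = s.re + 2 := by simp; ring
  rw [e] at hb
  refine le_trans ?_ hb
  nlinarith [mul_nonneg (norm_nonneg (Complex.Gamma s)) hpos.le]

/-- The average `z ^ (-β) ∫₀^z v ^ (β - 1) k(v) dv` of the Bessel kernel, which is the function
`G^{2,1}_{1,3}(z | 1 - β; a - 1, 0, -β)`. -/
noncomputable def averagedKernel (a β z : ℝ) : ℝ :=
  z ^ (-β) * ∫ v in Ioo 0 z, v ^ (β - 1) * besselKernel a v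

/-- The integrand is the modulus of the Mellin integrand of the kernel at `s = β`. -/
lemma integrableOn_rpow_mul_besselKernel {a β : ℝ} (ha : 1 ≤ a) (hβ : 0 < β) :
    IntegrableOn (fun v => v ^ (β - 1) * besselKernel a v) (Ioi 0) := by
  have h := (hasMellin_besselKernel (a := a) (s := β) (by simpa using hβ)
    (by simp; linarith)).1.norm
  refine IntegrableOn.congr_fun h (fun v hv => ?_) measurableSet_Ioi
  simp only
  rw [norm_smul, Complex.norm_cpow_eq_rpow_re_of_pos hv, Complex.norm_real,
    Real.norm_of_nonneg (besselKernel_nonneg _ _)]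
  simp

lemma continuousOn_averagedKernel {a β : ℝ} (ha : 1 ≤ a) (hβ : 0 < β) :
    ContinuousOn (averagedKernel a β) (Ioi 0) := by
  have hint := (integrableOn_rpow_mul_besselKernel ha hβ).integrable_indicator measurableSet_Ioi
  have hc := intervalIntegral.continuous_primitive (fun x y => hint.intervalIntegrable) 0
  have hp : ContinuousOn (fun z : ℝ => z ^ (-β)) (Ioi 0) :=
    continuousOn_id.rpow_const fun z hz => Or.inl (ne_of_gt hz)
  refine (hp.mul hc.continuousOn).congr fun z hz => ?_
  have hz : 0 < z := hz
  simp only [averagedKernel, Pi.mul_apply]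
  rw [intervalIntegral.integral_of_le hz.le, setIntegral_indicator measurableSet_Ioi,
    inter_eq_left.2 Ioc_subset_Ioi_self, integral_Ioc_eq_integral_Ioo]

lemma hasMellin_averagedKernel {a β : ℝ} (ha : 1 ≤ a) {s : ℂ} (hs : 0 < s.re) (hsβ : s.re < β) :
    HasMellin (fun z => (averagedKernel a β z : ℂ)) s
      (Complex.Gamma s * Complex.Gamma (s + a - 1) / (β - s)) := by
  have h := hasMellin_besselKernel (a := a) hs (by linarith)
  have := hasMellin_rpow_mul_integral (measurable_besselKernel a) hsβ h.1
  rwa [h.2] at this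

lemma integrable_inv_sq_add_sq {σ : ℝ} (hσ : 0 < σ) :
    Integrable fun y : ℝ => (σ ^ 2 + y ^ 2)⁻¹ := by
  -- The constant comes from `1 + y² ≤ (1 + σ⁻²) (σ² + y²)`.
  refine (integrable_inv_one_add_sq.const_mul (1 + (σ ^ 2)⁻¹)).mono' (by fun_prop)
    (Eventually.of_forall fun y => ?_)
  rw [Real.norm_of_nonneg (by positivity), ← div_eq_mul_inv, le_div_iff₀ (by positivity),
    inv_mul_le_iff₀ (by positivity)]
  have h : σ ^ 2 * (σ ^ 2)⁻¹ = 1 := mul_inv_cancel₀ (by positivity)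
  have : 0 ≤ y ^ 2 * (σ ^ 2)⁻¹ := by positivity
  nlinarith [sq_nonneg σ]

/-- One Gamma factor supplies the decay; the other is bounded by its value at the real part, and the
denominator is at least `β - σ`. -/
lemma verticalIntegrable_mellin_averagedKernel {a β σ : ℝ} (ha : 1 ≤ a) (hσ : 0 < σ)
    (hσβ : σ < β) :
    Complex.VerticalIntegrable (mellin fun z => (averagedKernel a β z : ℂ)) σ := by
  have hre (y : ℝ) : ((σ : ℂ) + y * Complex.I).re = σ := by simp
  have him (y : ℝ) : ((σ : ℂ) + y * Complex.I).im = y := by simp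
  have hM (y : ℝ) := (hasMellin_averagedKernel (β := β) ha (s := (σ : ℂ) + y * Complex.I)
    (by rwa [hre]) (by rwa [hre])).2
  have hden (y : ℝ) : β - σ ≤ ‖(β : ℂ) - (σ + y * Complex.I)‖ := by
    refine le_trans ?_ (Complex.re_le_norm _)
    simp
  have hcΓ {w : ℝ → ℂ} (hw : Continuous w) (hpos : ∀ y, 0 < (w y).re) :
      Continuous fun y => Complex.Gamma (w y) := by
    refine continuous_iff_continuousAt.2 fun y => ContinuousAt.comp ?_ hw.continuousAt
    refine (Complex.differentiableAt_Gamma _ fun m hm => ?_).continuousAt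
    have := hpos y
    rw [hm] at this
    simp at this
    linarith [(Nat.cast_nonneg m : (0 : ℝ) ≤ m)]
  unfold Complex.VerticalIntegrable
  simp only [hM]
  refine ((integrable_inv_sq_add_sq hσ).const_mul
    (Real.Gamma (σ + 2) * Real.Gamma (σ + a - 1) / (β - σ))).mono' ?_
    (Eventually.of_forall fun y => ?_)
  · refine Continuous.aestronglyMeasurable (Continuous.div ?_ (by fun_prop) fun y h => ?_)
    · refine (hcΓ (by fun_prop) fun y => ?_).mul (hcΓ (by fun_prop) fun y => ?_)
      · rwa [hre]
      · simp; linarith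
    · have := hden y
      rw [h, norm_zero] at this
      linarith
  · have h1 := norm_Gamma_le_div (s := (σ : ℂ) + y * Complex.I) (by rwa [hre])
    have h2 := norm_Gamma_le_Gamma_re (s := (σ : ℂ) + y * Complex.I + a - 1) (by simp; linarith)
    have e : ((σ : ℂ) + y * Complex.I + a - 1).re = σ + a - 1 := by simp
    rw [hre, him] at h1
    rw [e] at h2
    have hΓ : 0 < Real.Gamma (σ + 2) := Real.Gamma_pos_of_pos (by linarith)
    have hβσ : 0 < β - σ := by linarith
    rw [norm_div, norm_mul]
    calc _ ≤ Real.Gamma (σ + 2) / (σ ^ 2 + y ^ 2) * Real.Gamma (σ + a - 1) / (β - σ) := by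
          gcongr
          · exact (mul_nonneg (norm_nonneg _) (norm_nonneg _)).trans
              (mul_le_mul h1 h2 (norm_nonneg _) (by positivity))
          · exact hden y
      _ = _ := by rw [div_eq_mul_inv (Real.Gamma (σ + 2))]; ring

lemma mellinInv_averagedKernel {a β σ z : ℝ} (ha : 1 ≤ a) (hσ : 0 < σ) (hσβ : σ < β)
    (hz : 0 < z) :
    mellinInv σ (mellin fun z => (averagedKernel a β z : ℂ)) z = (averagedKernel a β z : ℂ) := by
  refine mellinInv_mellin_eq σ _ hz
    (hasMellin_averagedKernel ha (by simpa using hσ) (by simpa using hσβ)).1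
    (verticalIntegrable_mellin_averagedKernel ha hσ hσβ) ?_
  exact Complex.continuous_ofReal.continuousAt.comp
    ((continuousOn_averagedKernel ha (hσ.trans hσβ)).continuousAt (Ioi_mem_nhds hz))

/-! ### The Meijer function as an inverse Mellin transform -/

lemma meijerSeparates_iff {L : ℕ} (hL : 1 ≤ L) (δ c : ℝ) :
    MeijerSeparates 2 1 ![-2 / (δ : ℂ)] ![(L : ℂ) - 1, 0, -1 - 2 / (δ : ℂ)] c ↔
      -(1 + 2 / δ) < c ∧ c < 0 := by
  have hL' : (1 : ℝ) ≤ L := by exact_mod_cast hL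
  simp [MeijerSeparates, Fin.forall_fin_succ, neg_div]
  constructor
  · rintro ⟨⟨h1, h2⟩, h3⟩
    exact ⟨by linarith, h2⟩
  · rintro ⟨h1, h2⟩
    exact ⟨⟨by linarith, h2⟩, by linarith⟩

/-- With `w = 1 + 2 / δ + s`, the quotient `Γ(w) / Γ(w + 1)` collapses to `1 / w`. The sign of `s`
flips because Mellin inversion integrates `z ^ (-s)`. -/
lemma meijerIntegrand_eq_mellin {L : ℕ} (hL : 1 ≤ L) {δ : ℝ} (z : ℝ) {s : ℂ}
    (hs : -(1 + 2 / δ) < s.re) (hs0 : s.re < 0) :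
    meijerIntegrand 2 1 ![-2 / (δ : ℂ)] ![(L : ℂ) - 1, 0, -1 - 2 / (δ : ℂ)] z s =
      (z : ℂ) ^ s * mellin (fun z => (averagedKernel L (1 + 2 / δ) z : ℂ)) (-s) := by
  have hL' : (1 : ℝ) ≤ L := by exact_mod_cast hL
  rw [(hasMellin_averagedKernel hL' (s := -s) (by simpa using hs0) (by simp; linarith)).2]
  have hre : 0 < (1 + 2 / (δ : ℂ) + s).re := by
    rw [show (1 + 2 / (δ : ℂ)) = ((1 + 2 / δ : ℝ) : ℂ) by push_cast; ring, Complex.add_re,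
      Complex.ofReal_re]
    linarith
  have hne : 1 + 2 / (δ : ℂ) + s ≠ 0 := by
    intro h
    rw [h] at hre
    simp at hre
  have hΓ := Complex.Gamma_ne_zero_of_re_pos hre
  simp only [meijerIntegrand, Fin.prod_univ_three, Fin.prod_univ_one]
  simp
  rw [show 1 - (-1 - 2 / (δ : ℂ)) + s = (1 + 2 / δ + s) + 1 by ring,
    show 1 - -2 / (δ : ℂ) + s = 1 + 2 / δ + s by ring, Complex.Gamma_add_one _ hne,
    show -s + (L : ℂ) - 1 = L - 1 - s by ring]
  generalize 1 + 2 / (δ : ℂ) + s = w at *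
  field_simp

lemma meijer_line {L : ℕ} (hL : 1 ≤ L) {δ z c : ℝ} (hz : 0 < z) (hc : -(1 + 2 / δ) < c)
    (hc0 : c < 0) :
    Integrable (fun y : ℝ => meijerIntegrand 2 1 ![-2 / (δ : ℂ)]
      ![(L : ℂ) - 1, 0, -1 - 2 / (δ : ℂ)] (z : ℂ) ((c : ℂ) + (y : ℂ) * Complex.I)) ∧
    meijerLineIntegral 2 1 ![-2 / (δ : ℂ)] ![(L : ℂ) - 1, 0, -1 - 2 / (δ : ℂ)] (z : ℂ) c =
      (averagedKernel L (1 + 2 / δ) z : ℂ) := by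
  have hL' : (1 : ℝ) ≤ L := by exact_mod_cast hL
  set M := mellin fun z => (averagedKernel L (1 + 2 / δ) z : ℂ) with hM
  set G : ℝ → ℂ := fun y => (z : ℂ) ^ (-(((-c : ℝ) : ℂ) + y * Complex.I)) *
    M (((-c : ℝ) : ℂ) + y * Complex.I) with hG
  have hGint : Integrable G := by
    have h := verticalIntegrable_mellin_averagedKernel (β := 1 + 2 / δ) (σ := -c) hL'
      (by linarith) (by linarith)
    refine Integrable.bdd_mul (c := z ^ c) h ?_ (Eventually.of_forall fun y => ?_)
    · exact Measurable.aestronglyMeasurable (by fun_prop)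
    · rw [Complex.norm_cpow_eq_rpow_re_of_pos hz]
      simp
  -- The point `c + i y` corresponds to `-c - i y` on the Mellin side, whence the reflection `y ↦
  -- -y`.
  have hpt (y : ℝ) : meijerIntegrand 2 1 ![-2 / (δ : ℂ)] ![(L : ℂ) - 1, 0, -1 - 2 / (δ : ℂ)]
      (z : ℂ) ((c : ℂ) + (y : ℂ) * Complex.I) = G (-y) := by
    rw [meijerIntegrand_eq_mellin hL z (by simpa using hc) (by simpa using hc0)]
    have e : ((-c : ℝ) : ℂ) + ((-y : ℝ) : ℂ) * Complex.I = -((c : ℂ) + y * Complex.I) := by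
      push_cast; ring
    simp only [hG, hM, e, neg_neg]
  constructor
  · simp only [hpt]
    exact hGint.comp_neg
  · have hinv := mellinInv_averagedKernel (β := 1 + 2 / δ) (σ := -c) hL' (by linarith)
      (by linarith) hz
    rw [← hinv, mellinInv, meijerLineIntegral]
    simp only [hpt, smul_eq_mul]
    rw [integral_mul_const, integral_neg_eq_self G, Complex.real_smul]
    have : (Real.pi : ℂ) ≠ 0 := by exact_mod_cast Real.pi_ne_zero
    have e : ∫ y : ℝ, (z : ℂ) ^ (-(((-c : ℝ) : ℂ) + y * Complex.I)) *
        mellin (fun z => (averagedKernel L (1 + 2 / δ) z : ℂ)) (((-c : ℝ) : ℂ) + y * Complex.I) =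
        ∫ y, G y := rfl
    rw [e]
    push_cast
    field_simp

lemma meijerG_eq_averagedKernel {L : ℕ} (hL : 1 ≤ L) {δ z : ℝ} (hδ : 0 < δ) (hz : 0 < z) :
    meijerG 2 1 ![-2 / (δ : ℂ)] ![(L : ℂ) - 1, 0, -1 - 2 / (δ : ℂ)] (z : ℂ) =
      (averagedKernel L (1 + 2 / δ) z : ℂ) := by
  have hex : ∃ c : ℝ, MeijerSeparates 2 1 ![-2 / (δ : ℂ)]
      ![(L : ℂ) - 1, 0, -1 - 2 / (δ : ℂ)] c := by
    refine ⟨-1, (meijerSeparates_iff hL δ _).2 ⟨?_, by norm_num⟩⟩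
    have : 0 < 2 / δ := by positivity
    linarith
  have h := (meijerSeparates_iff hL δ _).1 hex.choose_spec
  rw [meijerG, dif_pos hex]
  exact (meijer_line hL hz h.1 h.2).2

lemma meijerGWellDefined {L : ℕ} (hL : 1 ≤ L) {δ z : ℝ} (hδ : 0 < δ) (hz : 0 < z) :
    MeijerGWellDefined 2 1 ![-2 / (δ : ℂ)] ![(L : ℂ) - 1, 0, -1 - 2 / (δ : ℂ)] (z : ℂ) := by
  refine ⟨⟨-1, (meijerSeparates_iff hL δ _).2 ⟨?_, by norm_num⟩⟩, fun c hc => ?_⟩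
  · have : 0 < 2 / δ := by positivity
    linarith
  · rw [meijerSeparates_iff hL] at hc
    rw [meijerG_eq_averagedKernel hL hδ hz]
    exact meijer_line hL hz hc.1 hc.2

/-! ### The density of the SNR -/

lemma measurable_averagedKernel (a β : ℝ) : Measurable (averagedKernel a β) := by
  have hset : MeasurableSet {p : ℝ × ℝ | 0 < p.2 ∧ p.2 < p.1} :=
    (measurableSet_lt measurable_const measurable_snd).inter
      (measurableSet_lt measurable_snd measurable_fst)
  have hk := measurable_besselKernel a
  have h : StronglyMeasurable fun z => ∫ v, {p : ℝ × ℝ | 0 < p.2 ∧ p.2 < p.1}.indicator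
      (fun p => p.2 ^ (β - 1) * besselKernel a p.2) (z, v) := by
    refine StronglyMeasurable.integral_prod_right'
      (f := {p : ℝ × ℝ | 0 < p.2 ∧ p.2 < p.1}.indicator
        (fun p => p.2 ^ (β - 1) * besselKernel a p.2)) ?_
    exact (Measurable.indicator (by fun_prop) hset).stronglyMeasurable
  have e : averagedKernel a β = fun z => z ^ (-β) *
      ∫ v, {p : ℝ × ℝ | 0 < p.2 ∧ p.2 < p.1}.indicator
        (fun p => p.2 ^ (β - 1) * besselKernel a p.2) (z, v) := by
    ext z
    rw [averagedKernel, ← integral_indicator measurableSet_Ioo]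
    rfl
  rw [e]
  have hm := h.measurable
  fun_prop

lemma image_rpow_mul_Ioi {δ b : ℝ} (hδ : 0 < δ) (hb : 0 < b) :
    (fun r : ℝ => r ^ δ * b) '' Ioi 0 = Ioi 0 := by
  ext y
  simp only [mem_image, mem_Ioi]
  constructor
  · rintro ⟨r, hr, rfl⟩
    positivity
  · intro hy
    refine ⟨(y / b) ^ δ⁻¹, by positivity, ?_⟩
    rw [Real.rpow_inv_rpow (by positivity) hδ.ne']
    field_simp

lemma image_rpow_mul_Ioo {δ b R : ℝ} (hδ : 0 < δ) (hb : 0 < b) (hR : 0 ≤ R) :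
    (fun r : ℝ => r ^ δ * b) '' Ioo 0 R = Ioo 0 (R ^ δ * b) := by
  ext y
  simp only [mem_image, mem_Ioo]
  constructor
  · rintro ⟨r, ⟨hr, hrR⟩, rfl⟩
    exact ⟨by positivity, by gcongr⟩
  · rintro ⟨hy, hyR⟩
    have h : 0 < (y / b) ^ δ⁻¹ := by positivity
    refine ⟨(y / b) ^ δ⁻¹, ⟨h, ?_⟩, ?_⟩
    · rw [← Real.rpow_lt_rpow_iff h.le hR hδ, Real.rpow_inv_rpow (by positivity) hδ.ne',
        div_lt_iff₀ hb]
      exact hyR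
    · rw [Real.rpow_inv_rpow (by positivity) hδ.ne']
      field_simp

lemma hasDerivWithinAt_rpow_mul (δ b : ℝ) {r : ℝ} (hr : 0 < r) (s : Set ℝ) :
    HasDerivWithinAt (fun r : ℝ => r ^ δ * b) (δ * r ^ (δ - 1) * b) s r :=
  ((Real.hasDerivAt_rpow_const (Or.inl hr.ne')).mul_const b).hasDerivWithinAt

lemma injOn_rpow_mul {δ b : ℝ} (hδ : 0 < δ) (hb : 0 < b) :
    InjOn (fun r : ℝ => r ^ δ * b) (Ioi 0) := by
  intro x hx y hy h
  exact Real.rpow_left_injOn hδ.ne' (show (0 : ℝ) ≤ x from le_of_lt hx)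
    (show (0 : ℝ) ≤ y from le_of_lt hy) (mul_right_cancel₀ hb.ne' h)

/-- Explains `β = 1 + 2 / δ`: under `v = r ^ δ * b`, the weight `v ^ (β - 1) dv` becomes a constant
times `r ^ (1 + δ) dr`, the `r` of the ring density times the scaling factor `r ^ δ`. -/
lemma abs_deriv_smul_rpow_mul {δ b r : ℝ} (hδ : 0 < δ) (hb : 0 < b) (hr : 0 < r) (k : ℝ) :
    |δ * r ^ (δ - 1) * b| • ((r ^ δ * b) ^ (1 + 2 / δ - 1) * k) =
      δ * b ^ (1 + 2 / δ) * (r ^ (1 + δ) * k) := by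
  rw [abs_of_pos (by positivity), smul_eq_mul, add_sub_cancel_left,
    Real.mul_rpow (by positivity) hb.le, ← Real.rpow_mul hr.le, mul_div_cancel₀ _ hδ.ne',
    Real.rpow_add hb, Real.rpow_one, show 1 + δ = (δ - 1) + 2 by ring, Real.rpow_add hr]
  ring

lemma integrableOn_rpow_mul_besselKernel_comp {a δ b : ℝ} (ha : 1 ≤ a) (hδ : 0 < δ)
    (hb : 0 < b) :
    IntegrableOn (fun r => r ^ (1 + δ) * besselKernel a (r ^ δ * b)) (Ioi 0) := by
  have hβ : 0 < 1 + 2 / δ := by positivity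
  have h := (integrableOn_image_iff_integrableOn_abs_deriv_smul measurableSet_Ioi
    (fun r hr => hasDerivWithinAt_rpow_mul δ b hr _) (injOn_rpow_mul hδ hb)
    (fun v => v ^ (1 + 2 / δ - 1) * besselKernel a v)).1 (by
      rw [image_rpow_mul_Ioi hδ hb]
      exact integrableOn_rpow_mul_besselKernel ha hβ)
  refine IntegrableOn.congr_fun (h.const_mul (δ * b ^ (1 + 2 / δ))⁻¹) (fun r hr => ?_)
    measurableSet_Ioi
  have : δ * b ^ (1 + 2 / δ) ≠ 0 := by positivity
  rw [abs_deriv_smul_rpow_mul hδ hb hr, inv_mul_cancel_left₀ this]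

lemma rpow_mul_averagedKernel {a δ b R : ℝ} (hδ : 0 < δ) (hb : 0 < b) (hR : 0 ≤ R) :
    R ^ (2 + δ) * averagedKernel a (1 + 2 / δ) (R ^ δ * b) =
      δ * ∫ r in (0 : ℝ)..R, r ^ (1 + δ) * besselKernel a (r ^ δ * b) := by
  rcases hR.eq_or_lt with rfl | hR
  · simp [Real.zero_rpow (by linarith : 2 + δ ≠ 0)]
  have h := integral_image_eq_integral_abs_deriv_smul measurableSet_Ioo
    (fun r (hr : r ∈ Ioo 0 R) => hasDerivWithinAt_rpow_mul δ b hr.1 _)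
    ((injOn_rpow_mul hδ hb).mono Ioo_subset_Ioi_self)
    (fun v => v ^ (1 + 2 / δ - 1) * besselKernel a v)
  rw [image_rpow_mul_Ioo hδ hb hR.le, setIntegral_congr_fun measurableSet_Ioo
    fun r hr => abs_deriv_smul_rpow_mul hδ hb hr.1 _, integral_const_mul] at h
  rw [averagedKernel, h, intervalIntegral.integral_of_le hR.le, integral_Ioc_eq_integral_Ioo,
    Real.mul_rpow (by positivity) hb.le, ← Real.rpow_mul hR.le, Real.rpow_neg hb.le,
    show δ * -(1 + 2 / δ) = -(2 + δ) by field_simp; ring, Real.rpow_neg hR.le]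
  have h1 : R ^ (2 + δ) ≠ 0 := by positivity
  have h2 : b ^ (1 + 2 / δ) ≠ 0 := by positivity
  generalize ∫ r in Ioo 0 R, r ^ (1 + δ) * besselKernel a (r ^ δ * b) = J
  field_simp

/-- The density of the received SNR. -/
noncomputable def snrPDF (a δ γbar R₁ R₂ γ : ℝ) : ℝ :=
  if 0 < γ then 1 / (2 * δ * γbar * Real.Gamma a * (R₂ ^ 2 - R₁ ^ 2)) *
    (R₂ ^ (2 + δ) * averagedKernel a (1 + 2 / δ) (R₂ ^ δ * γ / (4 * γbar)) -
      R₁ ^ (2 + δ) * averagedKernel a (1 + 2 / δ) (R₁ ^ δ * γ / (4 * γbar)))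
  else 0

lemma measurable_snrPDF (a δ γbar R₁ R₂ : ℝ) : Measurable (snrPDF a δ γbar R₁ R₂) := by
  have h := measurable_averagedKernel a (1 + 2 / δ)
  unfold snrPDF
  exact Measurable.ite measurableSet_Ioi (by fun_prop) measurable_const

section

variable {a δ γbar R₁ R₂ : ℝ}

/-- The difference of the two averages is an integral over the ring radii, which makes nonnegativity
visible and gives the form produced by conditioning on the distance. -/
lemma snrPDF_eq_integral (ha : 1 ≤ a) (hδ : 0 < δ) (hγbar : 0 < γbar) (hR₁ : 0 ≤ R₁)
    (hR : R₁ < R₂) {γ : ℝ} (hγ : 0 < γ) :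
    snrPDF a δ γbar R₁ R₂ γ = ∫ r in Ioc R₁ R₂, 2 * r / (R₂ ^ 2 - R₁ ^ 2) *
      (r ^ δ / γbar * (besselKernel a (r ^ δ / γbar * γ / 4) / (4 * Real.Gamma a))) := by
  have hb : 0 < γ / (4 * γbar) := by positivity
  have hint (R : ℝ) (hR : 0 ≤ R) : IntervalIntegrable
      (fun r => r ^ (1 + δ) * besselKernel a (r ^ δ * (γ / (4 * γbar)))) volume 0 R := by
    rw [intervalIntegrable_iff_integrableOn_Ioc_of_le hR]
    exact (integrableOn_rpow_mul_besselKernel_comp ha hδ hb).mono_set Ioc_subset_Ioi_self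
  have hR₂ : 0 ≤ R₂ := hR₁.trans hR.le
  rw [snrPDF, if_pos hγ, mul_div_assoc, mul_div_assoc, rpow_mul_averagedKernel hδ hb hR₂,
    rpow_mul_averagedKernel hδ hb hR₁, ← mul_sub,
    intervalIntegral.integral_interval_sub_left (hint _ hR₂) (hint _ hR₁),
    intervalIntegral.integral_of_le hR.le, ← mul_assoc, ← integral_const_mul]
  refine setIntegral_congr_fun measurableSet_Ioc fun r hr => ?_
  have hr : 0 < r := hR₁.trans_lt hr.1
  have e : r ^ δ * (γ / (4 * γbar)) = r ^ δ / γbar * γ / 4 := by field_simp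
  have hΓ : Real.Gamma a ≠ 0 := (Real.Gamma_pos_of_pos (by linarith)).ne'
  have hne : R₂ ^ 2 - R₁ ^ 2 ≠ 0 := by nlinarith
  simp only [e, Real.rpow_add hr, Real.rpow_one]
  field_simp
  ring

lemma ring_integrand_nonneg (ha : 1 ≤ a) (hγbar : 0 < γbar) (hR₁ : 0 ≤ R₁) (hR : R₁ < R₂)
    {γ r : ℝ} (hr : r ∈ Ioc R₁ R₂) :
    0 ≤ 2 * r / (R₂ ^ 2 - R₁ ^ 2) *
      (r ^ δ / γbar * (besselKernel a (r ^ δ / γbar * γ / 4) / (4 * Real.Gamma a))) := by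
  have hr : 0 < r := hR₁.trans_lt hr.1
  have hΓ := Real.Gamma_pos_of_pos (show 0 < a by linarith)
  have hpos : 0 < R₂ ^ 2 - R₁ ^ 2 := by nlinarith
  have := besselKernel_nonneg a (r ^ δ / γbar * γ / 4)
  positivity

lemma snrPDF_nonneg (ha : 1 ≤ a) (hδ : 0 < δ) (hγbar : 0 < γbar) (hR₁ : 0 ≤ R₁)
    (hR : R₁ < R₂) (γ : ℝ) : 0 ≤ snrPDF a δ γbar R₁ R₂ γ := by
  by_cases hγ : 0 < γ
  · rw [snrPDF_eq_integral ha hδ hγbar hR₁ hR hγ]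
    exact setIntegral_nonneg measurableSet_Ioc fun r hr =>
      ring_integrand_nonneg ha hγbar hR₁ hR hr
  · simp [snrPDF, hγ]

lemma lintegral_ring_eq_snrPDF (ha : 1 ≤ a) (hδ : 0 < δ) (hγbar : 0 < γbar) (hR₁ : 0 ≤ R₁)
    (hR : R₁ < R₂) {γ : ℝ} (hγ : 0 < γ) :
    ∫⁻ r in Ioc R₁ R₂, ENNReal.ofReal (2 * r / (R₂ ^ 2 - R₁ ^ 2) *
      (r ^ δ / γbar * (besselKernel a (r ^ δ / γbar * γ / 4) / (4 * Real.Gamma a)))) =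
      ENNReal.ofReal (snrPDF a δ γbar R₁ R₂ γ) := by
  have hb : 0 < γ / (4 * γbar) := by positivity
  rw [snrPDF_eq_integral ha hδ hγbar hR₁ hR hγ, ofReal_integral_eq_lintegral_ofReal]
  · have h := ((integrableOn_rpow_mul_besselKernel_comp ha hδ hb).mono_set
      (Ioc_subset_Ioi_self.trans (Ioi_subset_Ioi hR₁) : Ioc R₁ R₂ ⊆ Ioi 0)).const_mul
      (2 / (R₂ ^ 2 - R₁ ^ 2) / γbar / (4 * Real.Gamma a))
    refine IntegrableOn.congr_fun h (fun r hr => ?_) measurableSet_Ioc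
    have hr : 0 < r := hR₁.trans_lt hr.1
    have e : r ^ δ * (γ / (4 * γbar)) = r ^ δ / γbar * γ / 4 := by field_simp
    simp only [e, Real.rpow_add hr, Real.rpow_one]
    ring
  · filter_upwards [self_mem_ae_restrict measurableSet_Ioc] with r hr
    exact ring_integrand_nonneg ha hγbar hR₁ hR hr

/-- The law of `γ̄ X / d ^ δ` for independent `X = 4 T E` and `d` has the density `snrPDF`. -/
lemma map_snr_eq_withDensity (ha : 1 ≤ a) (hδ : 0 < δ) (hγbar : 0 < γbar) (hR₁ : 0 ≤ R₁)
    (hR : R₁ < R₂) :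
    (Measure.prod (((gammaMeasure a 1).prod (gammaMeasure 1 1)).map fun p => 4 * p.1 * p.2)
      (volume.withDensity fun r => ENNReal.ofReal (ringPDF R₁ R₂ r))).map
        (fun q => γbar * q.1 / q.2 ^ δ) =
      volume.withDensity fun γ => ENNReal.ofReal (snrPDF a δ γbar R₁ R₂ γ) := by
  have ha0 : 0 < a := by linarith
  have := isProbabilityMeasure_gammaMeasure (one_pos (α := ℝ)) one_pos
  have := isProbabilityMeasure_gammaMeasure ha0 one_pos
  have hk := measurable_besselKernel a
  have hpos : 0 < R₂ ^ 2 - R₁ ^ 2 := by nlinarith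
  have hΓ := Real.Gamma_pos_of_pos ha0
  refine Measure.ext_of_lintegral _ fun F hF => ?_
  have hm : Measurable fun q : ℝ × ℝ => F (γbar * q.1 / q.2 ^ δ) := by fun_prop
  -- The null endpoint `R₁` is dropped so that `r > 0` throughout, even when `R₁ = 0`.
  rw [lintegral_map hF (by fun_prop), lintegral_prod_symm _ hm.aemeasurable,
    lintegral_withDensity_ringPDF (Measurable.lintegral_prod_left' hm),
    ← setLIntegral_congr Ioc_ae_eq_Icc]
  have h1 : ∀ r ∈ Ioc R₁ R₂, ENNReal.ofReal (2 * r / (R₂ ^ 2 - R₁ ^ 2)) *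
      ∫⁻ x, F (γbar * x / r ^ δ)
        ∂(((gammaMeasure a 1).prod (gammaMeasure 1 1)).map fun p => 4 * p.1 * p.2) =
      ∫⁻ γ in Ioi 0, ENNReal.ofReal (2 * r / (R₂ ^ 2 - R₁ ^ 2) *
        (r ^ δ / γbar * (besselKernel a (r ^ δ / γbar * γ / 4) / (4 * Real.Gamma a)))) *
        F γ := by
    intro r hr
    have hr : 0 < r := hR₁.trans_lt hr.1
    have hc : 0 < r ^ δ / γbar := by positivity
    rw [lintegral_map (by fun_prop) (by fun_prop),
      lintegral_four_mul_gamma_exp ha0 (F := fun x => F (γbar * x / r ^ δ)) (by fun_prop),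
      lintegral_Ioi_comp_mul_left hc, ← lintegral_const_mul _ (by fun_prop)]
    refine lintegral_congr fun γ => ?_
    rw [ENNReal.ofReal_mul (by positivity), ENNReal.ofReal_mul hc.le,
      show γbar * (r ^ δ / γbar * γ) / r ^ δ = γ by field_simp]
    simp only [mul_assoc]
  rw [setLIntegral_congr_fun measurableSet_Ioc h1, lintegral_lintegral_swap (by fun_prop),
    lintegral_withDensity_eq_lintegral_mul _ (measurable_snrPDF _ _ _ _ _).ennreal_ofReal hF,
    ← lintegral_indicator measurableSet_Ioi]
  refine lintegral_congr fun γ => ?_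
  by_cases hγ : 0 < γ
  · rw [indicator_of_mem (show γ ∈ Ioi 0 from hγ), lintegral_mul_const _ (by fun_prop),
      lintegral_ring_eq_snrPDF ha hδ hγbar hR₁ hR hγ]
    rfl
  · simp [snrPDF, hγ]

end

lemma ofReal_snrPDF {L : ℕ} (hL : 1 ≤ L) {δ γbar R₁ R₂ : ℝ} (hδ : 0 < δ) (hγbar : 0 < γbar)
    (hR₁ : 0 ≤ R₁) (hR : R₁ < R₂) {γ : ℝ} (hγ : 0 < γ) :
    (snrPDF L δ γbar R₁ R₂ γ : ℂ) =
      1 / (2 * (δ : ℂ) * (γbar : ℂ) * (Real.Gamma L : ℂ) * ((R₂ : ℂ) ^ 2 - (R₁ : ℂ) ^ 2)) *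
      (((R₂ ^ (2 + δ) : ℝ) : ℂ) *
          meijerG 2 1 ![-2 / (δ : ℂ)] ![(L : ℂ) - 1, 0, -1 - 2 / (δ : ℂ)]
            ((R₂ ^ δ * γ / (4 * γbar) : ℝ) : ℂ) -
        ((R₁ ^ (2 + δ) : ℝ) : ℂ) *
          meijerG 2 1 ![-2 / (δ : ℂ)] ![(L : ℂ) - 1, 0, -1 - 2 / (δ : ℂ)]
            ((R₁ ^ δ * γ / (4 * γbar) : ℝ) : ℂ)) := by
  have hterm {R : ℝ} (hR : 0 ≤ R) : ((R ^ (2 + δ) : ℝ) : ℂ) *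
      meijerG 2 1 ![-2 / (δ : ℂ)] ![(L : ℂ) - 1, 0, -1 - 2 / (δ : ℂ)]
        ((R ^ δ * γ / (4 * γbar) : ℝ) : ℂ) =
      ((R ^ (2 + δ) : ℝ) : ℂ) *
        (averagedKernel L (1 + 2 / δ) (R ^ δ * γ / (4 * γbar)) : ℂ) := by
    -- At `R = 0` the prefactor `R ^ (2 + δ)` vanishes, so the value of `meijerG` at `0` is
    -- irrelevant.
    rcases hR.eq_or_lt with rfl | hR
    · simp [Real.zero_rpow (by linarith : 2 + δ ≠ 0)]
    · rw [meijerG_eq_averagedKernel hL hδ (by positivity)]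
  rw [hterm hR₁, hterm (hR₁.trans hR.le), snrPDF, if_pos hγ]
  push_cast
  rfl

lemma measureReal_four_mul_gamma_exp_le {L : ℕ} (hL : 1 ≤ L) {x : ℝ} (hx : 0 < x) :
    (((gammaMeasure L 1).prod (gammaMeasure 1 1)).map fun p => 4 * p.1 * p.2).real
      {y | y ≤ x} =
    1 - (2 : ℝ) ^ (1 - (L : ℝ)) / Real.Gamma L * Real.sqrt x ^ L *
      besselK L (Real.sqrt x) := by
  have hL0 : (0 : ℝ) < L := by exact_mod_cast hL
  have hΓ := Real.Gamma_pos_of_pos hL0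
  have := isProbabilityMeasure_gammaMeasure (one_pos (α := ℝ)) one_pos
  have := isProbabilityMeasure_gammaMeasure hL0 one_pos
  have hs : MeasurableSet {p : ℝ × ℝ | x < 4 * p.1 * p.2} :=
    measurableSet_lt measurable_const (by fun_prop)
  have hcompl : {p : ℝ × ℝ | 4 * p.1 * p.2 ≤ x} = {p : ℝ × ℝ | x < 4 * p.1 * p.2}ᶜ := by
    ext p
    simp
  have hsq : √(x / 4) = √x / 2 := by
    rw [Real.sqrt_div hx.le, show (4 : ℝ) = 2 ^ 2 by norm_num, Real.sqrt_sq (by norm_num)]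
  rw [map_measureReal_apply (s := {y | y ≤ x}) (by fun_prop) measurableSet_Iic]
  change Measure.real _ {p : ℝ × ℝ | 4 * p.1 * p.2 ≤ x} = _
  rw [hcompl, probReal_compl_eq_one_sub hs, measureReal_def,
    measure_four_mul_gamma_exp_gt hL0 hx,
    ENNReal.toReal_ofReal (div_nonneg (besselKernel_nonneg _ _) hΓ.le),
    besselKernel_eq_besselK hL0 (by positivity), hsq, Real.div_rpow (by positivity) two_pos.le,
    mul_div_cancel₀ _ two_ne_zero, Real.rpow_natCast, Real.rpow_sub two_pos, Real.rpow_one]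
  ring

/-! ### From product laws to the random variables -/

section

variable {Ω : Type*} [MeasurableSpace Ω] {μ : Measure Ω}

lemma hasLaw_channelMeasure [IsProbabilityMeasure μ] {L : ℕ} {h g ε : Fin L → Ω → ℝ}
    (hh : ∀ l, HasLaw (h l) (rayleighMeasure 1) μ) (hg : ∀ l, HasLaw (g l) (rayleighMeasure 1) μ)
    (hε : ∀ l, HasLaw (ε l) phaseMeasure μ)
    (hindep : iIndepFun (fun i : Fin L ⊕ Fin L ⊕ Fin L => Sum.elim h (Sum.elim g ε) i) μ) :
    HasLaw (fun ω (i : Fin L ⊕ Fin L ⊕ Fin L) => Sum.elim h (Sum.elim g ε) i ω)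
      (channelMeasure L) μ := by
  have hae : ∀ i : Fin L ⊕ Fin L ⊕ Fin L, AEMeasurable (Sum.elim h (Sum.elim g ε) i) μ := by
    rintro (i | i | i)
    exacts [(hh i).aemeasurable, (hg i).aemeasurable, (hε i).aemeasurable]
  refine ⟨aemeasurable_pi_lambda _ hae, ?_⟩
  rw [(iIndepFun_iff_map_fun_eq_pi_map hae).1 hindep, channelMeasure]
  congr 1
  ext1 i
  rcases i with i | i | i
  exacts [(hh i).map_eq, (hg i).map_eq, (hε i).map_eq]

lemma hasLaw_gain [IsProbabilityMeasure μ] {L : ℕ} (hL : 1 ≤ L) {h g ε : Fin L → Ω → ℝ}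
    (hh : ∀ l, HasLaw (h l) (rayleighMeasure 1) μ) (hg : ∀ l, HasLaw (g l) (rayleighMeasure 1) μ)
    (hε : ∀ l, HasLaw (ε l) phaseMeasure μ)
    (hindep : iIndepFun (fun i : Fin L ⊕ Fin L ⊕ Fin L => Sum.elim h (Sum.elim g ε) i) μ) :
    HasLaw (fun ω => gain (fun l => h l ω) (fun l => g l ω) (fun l => ε l ω))
      (((gammaMeasure L 1).prod (gammaMeasure 1 1)).map fun p => 4 * p.1 * p.2) μ := by
  have hgain : Measurable fun x : Fin L ⊕ Fin L ⊕ Fin L → ℝ => gain (fun l => x (.inl l))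
      (fun l => x (.inr (.inl l))) fun l => x (.inr (.inr l)) :=
    measurable_gain (by fun_prop) (by fun_prop) (by fun_prop)
  have hT := hasLaw_channelMeasure hh hg hε hindep
  have hY : HasLaw (fun x : Fin L ⊕ Fin L ⊕ Fin L → ℝ => gain (fun l => x (.inl l))
      (fun l => x (.inr (.inl l))) fun l => x (.inr (.inr l)))
      (((gammaMeasure L 1).prod (gammaMeasure 1 1)).map fun p => 4 * p.1 * p.2)
      (channelMeasure L) := ⟨hgain.aemeasurable, map_gain_channelMeasure L hL⟩
  simpa only [Sum.elim_inl, Sum.elim_inr] using hY.fun_comp hT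

lemma hasLaw_dist {D : Ω → EuclideanSpace ℝ (Fin 2)} (c : EuclideanSpace ℝ (Fin 2)) {R₁ R₂ : ℝ}
    (hR₁ : 0 ≤ R₁) (hR : R₁ < R₂)
    (hD : HasLaw D (ProbabilityTheory.cond volume (planarRing c R₁ R₂)) μ) :
    HasLaw (fun ω => dist (D ω) c)
      (volume.withDensity fun r => ENNReal.ofReal (ringPDF R₁ R₂ r)) μ :=
  HasLaw.fun_comp (Y := fun x => dist x c)
    ⟨by fun_prop, map_dist_cond_planarRing c hR₁ hR⟩ hD

end

end RIS

theorem proposition1 {Ω : Type*} [MeasurableSpace Ω] (μ : MeasureTheory.Measure Ω)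
    [MeasureTheory.IsProbabilityMeasure μ]
    (L : ℕ) (hL : 1 ≤ L) (δ γbar R₁ R₂ : ℝ) (hδ : 0 < δ) (hγbar : 0 < γbar)
    (hR₁ : 0 ≤ R₁) (hR : R₁ < R₂) (center : EuclideanSpace ℝ (Fin 2))
    (h g ε : Fin L → Ω → ℝ) (D : Ω → EuclideanSpace ℝ (Fin 2))
    (hh : ∀ l, ProbabilityTheory.HasLaw (h l) (RIS.rayleighMeasure 1) μ)
    (hg : ∀ l, ProbabilityTheory.HasLaw (g l) (RIS.rayleighMeasure 1) μ)
    (hε : ∀ l, ProbabilityTheory.HasLaw (ε l)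
      (ProbabilityTheory.cond MeasureTheory.volume (Set.Ioo (-Real.pi) Real.pi)) μ)
    (hD : ProbabilityTheory.HasLaw D
      (ProbabilityTheory.cond MeasureTheory.volume (RIS.planarRing center R₁ R₂)) μ)
    (hindep : ProbabilityTheory.iIndepFun
      (fun i : Fin L ⊕ Fin L ⊕ Fin L => Sum.elim h (Sum.elim g ε) i) μ)
    (hindepD : ProbabilityTheory.IndepFun
      (fun ω (i : Fin L ⊕ Fin L ⊕ Fin L) => Sum.elim h (Sum.elim g ε) i ω) D μ) :
    -- distribution function of the combining gain
    (∀ x : ℝ, 0 < x →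
      μ.real {ω | RIS.gain (fun l => h l ω) (fun l => g l ω) (fun l => ε l ω) ≤ x} =
        1 - (2 : ℝ) ^ (1 - (L : ℝ)) / Real.Gamma L * Real.sqrt x ^ L *
          RIS.besselK L (Real.sqrt x)) ∧
    -- density of the distance
    ProbabilityTheory.HasLaw (fun ω => dist (D ω) center)
      (MeasureTheory.volume.withDensity fun r => ENNReal.ofReal
        (if R₁ ≤ r ∧ r ≤ R₂ then 2 * r / (R₂ ^ 2 - R₁ ^ 2) else 0)) μ ∧
    -- the Meijer function in the density is given by absolutely convergent integrals
    (∀ z : ℝ, 0 < z →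
      RIS.MeijerGWellDefined 2 1 ![-2 / (δ : ℂ)] ![(L : ℂ) - 1, 0, -1 - 2 / (δ : ℂ)] (z : ℂ)) ∧
    -- density of the SNR
    ∃ f : ℝ → ℝ, Measurable f ∧ (∀ γ, 0 ≤ f γ) ∧ (∀ γ, γ ≤ 0 → f γ = 0) ∧
      (∀ γ, 0 < γ →
        (f γ : ℂ) =
          1 / (2 * (δ : ℂ) * (γbar : ℂ) * (Real.Gamma L : ℂ) * ((R₂ : ℂ) ^ 2 - (R₁ : ℂ) ^ 2)) *
          (((R₂ ^ (2 + δ) : ℝ) : ℂ) *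
              RIS.meijerG 2 1 ![-2 / (δ : ℂ)] ![(L : ℂ) - 1, 0, -1 - 2 / (δ : ℂ)]
                ((R₂ ^ δ * γ / (4 * γbar) : ℝ) : ℂ) -
            ((R₁ ^ (2 + δ) : ℝ) : ℂ) *
              RIS.meijerG 2 1 ![-2 / (δ : ℂ)] ![(L : ℂ) - 1, 0, -1 - 2 / (δ : ℂ)]
                ((R₁ ^ δ * γ / (4 * γbar) : ℝ) : ℂ))) ∧
      ProbabilityTheory.HasLaw
        (fun ω => RIS.snr γbar δ (fun l => h l ω) (fun l => g l ω) (fun l => ε l ω)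
          (dist (D ω) center))
        (MeasureTheory.volume.withDensity fun γ => ENNReal.ofReal (f γ)) μ := by
  have hL0 : (0 : ℝ) < L := by exact_mod_cast hL
  have hL1 : (1 : ℝ) ≤ L := by exact_mod_cast hL
  have := ProbabilityTheory.isProbabilityMeasure_gammaMeasure (one_pos (α := ℝ)) one_pos
  have := ProbabilityTheory.isProbabilityMeasure_gammaMeasure hL0 one_pos
  have hgain : Measurable fun x : Fin L ⊕ Fin L ⊕ Fin L → ℝ => RIS.gain (fun l => x (.inl l))
      (fun l => x (.inr (.inl l))) fun l => x (.inr (.inr l)) :=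
    RIS.measurable_gain (by fun_prop) (by fun_prop) (by fun_prop)
  have hX := RIS.hasLaw_gain hL hh hg hε hindep
  have hd := RIS.hasLaw_dist center hR₁ hR hD
  refine ⟨fun x hx => ?_, hd, fun z hz => RIS.meijerGWellDefined hL hδ hz,
    RIS.snrPDF L δ γbar R₁ R₂, RIS.measurable_snrPDF _ _ _ _ _,
    RIS.snrPDF_nonneg hL1 hδ hγbar hR₁ hR, fun γ hγ => by simp [RIS.snrPDF, hγ.not_gt],
    fun γ hγ => RIS.ofReal_snrPDF hL hδ hγbar hR₁ hR hγ, ?_⟩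
  · rw [hX.measureReal_eq (p := fun y => y ≤ x) measurableSet_Iic]
    exact RIS.measureReal_four_mul_gamma_exp_le hL hx
  -- The gain is a function of the whole channel vector and the distance a function of `D`, so their
  -- joint law is the product law.
  · have hind := hindepD.comp hgain (measurable_id.dist (measurable_const (a := center)))
    have hXd : ProbabilityTheory.HasLaw (fun ω =>
        (RIS.gain (fun l => h l ω) (fun l => g l ω) (fun l => ε l ω), dist (D ω) center))
        (MeasureTheory.Measure.prod (((ProbabilityTheory.gammaMeasure L 1).prod
          (ProbabilityTheory.gammaMeasure 1 1)).map fun p => 4 * p.1 * p.2)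
        (MeasureTheory.volume.withDensity fun r => ENNReal.ofReal (RIS.ringPDF R₁ R₂ r))) μ := by
      refine ⟨hX.aemeasurable.prodMk hd.aemeasurable, ?_⟩
      rw [← hX.map_eq, ← hd.map_eq]
      exact (ProbabilityTheory.indepFun_iff_map_prod_eq_prod_map_map hX.aemeasurable
        hd.aemeasurable).1 hind
    exact ProbabilityTheory.HasLaw.fun_comp (Y := fun q : ℝ × ℝ => γbar * q.1 / q.2 ^ δ)
      ⟨by fun_prop, RIS.map_snr_eq_withDensity hL1 hδ hγbar hR₁ hR⟩ hXd
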